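/- Let $F$ be a field of characteristic $0$, and let $e_{ij}$ be the $2\times 2$ matrix units over $F$. Put $M_1=Fe_{22}\oplus Fe_{12}$ and $M_2=Fe_{11}\oplus Fe_{12}$ (non-unital associative algebras), with the derivations $\delta(\alpha e_{22}+\beta e_{12})=\alpha e_{12}$ of $M_1$ and $\delta(\alpha e_{11}+\beta e_{12})=\alpha e_{12}$ of $M_2$. Let $M_1^\delta$, $M_2^\delta$ be $M_1$, $M_2$ with a Lie algebra $L$ acting on them by derivations through the one-dimensional Lie algebra $F\delta$ (the image of $L$ in $\mathrm{Der}(M_i)$ is $F\delta$, and a fixed element of $L$, also written $\delta$, acts as $\delta$ on both algebras). For a Lie algebra $L$ over $F$ with universal enveloping algebra $U(L)$, let $F\langle X|L\rangle$ be the free associative algebra (without constant terms) generated by the symbols $x_j^{h}$, where $j\ge 1$ and $h$ runs over a basis of $U(L)$; $x_j^h$ is extended linearly to all $h\in U(L)$, $x_j=x_j^1$, and $L$ acts by the derivations with $\gamma(x_j^h)=x_j^{\gamma h}$. For an associative algebra $A$ on which $L$ acts by derivations, $\mathrm{Id}^L(A)$ is the set of $f\in F\langle X|L\rangle$ that vanish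 under all substitutions $x_j\mapsto a_j\in A$, $x_j^h\mapsto h(a_j)$. A $T_L$-ideal is an ideal of the algebra $F\langle X|L\rangle$ invariant under $U(L)$ and under all endomorphisms commuting with $U(L)$, and $\langle S\rangle_{T_L}$ is the smallest one containing $S$. Let $P_n^L$ be the span of the multilinear monomials $x_{\sigma(1)}^{h_1}\cdots x_{\sigma(n)}^{h_n}$, $\sigma\in S_n$. Let $c_n^L(A)=\dim P_n^L/(P_n^L\cap \mathrm{Id}^L(A))$, and let $\chi_n^L(A)$ be the character of this quotient as an $S_n$-module, with $\sigma(x_i^h)=x_{\sigma(i)}^h$. Let $\chi_\lambda$ be the irreducible $S_n$-character of the partition $\lambda\vdash n$. **Theorem.** 1. If $L$ acts faithfully, that is, $L=F\delta$, then $$\mathrm{Id}^L(M_1^\delta)=\langle x[y,z],\ x^\delta y-y^\delta x,\ xy^\delta,\ x^{\delta^2}\rangle_{T_L},\qquad \mathrm{Id}^L(M_2^\delta)=\langle [x,y]z,\ xy^\delta-yx^\delta,\ x^\delta y,\ x^{\delta^2}\rangle_{T_L}.$$ For any $L$ acting through $F\delta$ the same equalities hold once the polynomials $x^\gamma$, for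 $\gamma\in L$ acting as $0$ on the algebra concerned, are added to the generators. 2. $c_n^L(M_1^\delta)=c_n^L(M_2^\delta)=n+1$ for all $n\ge 1$. 3. $\chi_n^L(M_1^\delta)=\chi_n^L(M_2^\delta)=2\chi_{(n)}+\chi_{(n-1,1)}$ for all $n\ge 2$, and $\chi_1^L(M_1^\delta)=\chi_1^L(M_2^\delta)=2\chi_{(1)}$. -/

import Mathlib

attribute [local instance] LieRing.ofAssociativeRing

noncomputable section

namespace DiffId

universe u v w z

/-! ### Derivations and the action of the universal enveloping algebra -/

section Derivations

variable (F : Type u) [Field F]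
variable (A : Type v) [NonUnitalRing A] [Module F A] [IsScalarTower F A A] [SMulCommClass F A A]

/-- The Lie algebra of derivations of an associative (not necessarily unital) `F`-algebra. -/
def Der : LieSubalgebra F (Module.End F A) where
  carrier := {D | ∀ a b : A, D (a * b) = D a * b + a * D b}
  add_mem' := by
    intro D E hD hE a b
    simp only [LinearMap.add_apply, hD a b, hE a b, add_mul, mul_add]
    abel
  zero_mem' := by intro a b; simp
  smul_mem' := by
    intro c D hD a b
    simp only [LinearMap.smul_apply, hD a b, smul_add, smul_mul_assoc, mul_smul_comm]
  lie_mem' := by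
    intro D E hD hE a b
    change ∀ a b : A, D (a * b) = D a * b + a * D b at hD
    change ∀ a b : A, E (a * b) = E a * b + a * E b at hE
    simp only [LieRing.of_associative_ring_bracket, LinearMap.sub_apply, Module.End.mul_apply,
      hD, hE, map_add, sub_mul, mul_sub]
    abel

variable {F A}
variable {L : Type w} [LieRing L] [LieAlgebra F L]

/-- The extension to `U(L)` of an action of `L` on `A` by derivations: `uAct ρ h a = h(a)`. -/
def uAct (ρ : L →ₗ⁅F⁆ Der F A) : UniversalEnvelopingAlgebra F L →ₐ[F] Module.End F A :=
  UniversalEnvelopingAlgebra.lift F ((Der F A).incl.comp ρ)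

end Derivations

/-! ### The free associative algebra with derivations

`I` indexes a basis `b` of `U(L)`.  The free generator `x_j ^ (b i)` is the pair `(j, i)`;
variables are numbered from `0`. -/

section Free

variable {F : Type u} [Field F]
variable {L : Type w} [LieRing L] [LieAlgebra F L]
variable {I : Type z}

/-- The free associative `F`-algebra (without constant terms) on the generators
`x_j ^ (h_i)`, `j ∈ ℕ`, `i ∈ I`: its basis consists of the nonempty words in the generators. -/
abbrev FreeDiff (F : Type u) [Field F] (I : Type z) : Type (max u z) :=
  MonoidAlgebra F (FreeSemigroup (ℕ × I))

/-- The free generator `x_j ^ (h_i)`. -/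
def gen (F : Type u) [Field F] {I : Type z} (p : ℕ × I) : FreeDiff F I :=
  MonoidAlgebra.single (FreeSemigroup.of p) 1

/-- The algebra homomorphism with prescribed values on the free generators. -/
def subst {A : Type v} [NonUnitalRing A] [Module F A] [IsScalarTower F A A] [SMulCommClass F A A]
    (f : ℕ × I → A) : FreeDiff F I →ₙₐ[F] A :=
  MonoidAlgebra.liftMagma F (FreeSemigroup.lift f)

@[simp] theorem subst_gen {A : Type v} [NonUnitalRing A] [Module F A] [IsScalarTower F A A]
    [SMulCommClass F A A] (f : ℕ × I → A) (p : ℕ × I) : subst f (gen F p) = f p := by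
  simp [subst, gen]

theorem hom_ext {A : Type v} [NonUnitalRing A] [Module F A] [IsScalarTower F A A]
    [SMulCommClass F A A] {φ ψ : FreeDiff F I →ₙₐ[F] A}
    (h : ∀ p, φ (gen F p) = ψ (gen F p)) : φ = ψ :=
  MonoidAlgebra.nonUnitalAlgHom_ext' F (FreeSemigroup.hom_ext (funext h))

/-- The value on a word of the derivation with prescribed values `f` on the generators:
the sum over all positions of the word with the letter `p` there replaced by `f p`. -/
def derivWord (f : ℕ × I → FreeDiff F I) : ℕ × I → List (ℕ × I) → FreeDiff F I
  | p, [] => f p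
  | p, q :: l => f p * MonoidAlgebra.single ⟨q, l⟩ 1 + gen F p * derivWord f q l

/-- The derivation of the free algebra with prescribed values `f` on the generators. -/
def derivFree (f : ℕ × I → FreeDiff F I) : Module.End F (FreeDiff F I) :=
  (Finsupp.linearCombination F fun w : FreeSemigroup (ℕ × I) => derivWord f w.head w.tail).comp
    (MonoidAlgebra.coeffLinearEquiv F).toLinearMap

theorem derivFree_single (f : ℕ × I → FreeDiff F I) (w : FreeSemigroup (ℕ × I)) (c : F) :
    derivFree f (MonoidAlgebra.single w c) = c • derivWord f w.head w.tail := by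
  simp [derivFree]

@[simp] theorem derivFree_gen (f : ℕ × I → FreeDiff F I) (p : ℕ × I) :
    derivFree f (gen F p) = f p := by
  simp [gen, derivFree_single, derivWord]

theorem derivWord_append (f : ℕ × I → FreeDiff F I) (q : ℕ × I) (l' : List (ℕ × I))
    (l : List (ℕ × I)) : ∀ p : ℕ × I, derivWord f p (l ++ q :: l') =
      derivWord f p l * MonoidAlgebra.single ⟨q, l'⟩ 1 +
        MonoidAlgebra.single ⟨p, l⟩ 1 * derivWord f q l' := by
  induction l with
  | nil => intro p; rfl
  | cons r l ih =>
    intro p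
    have h1 : (MonoidAlgebra.single ⟨r, l ++ q :: l'⟩ 1 : FreeDiff F I) =
        MonoidAlgebra.single ⟨r, l⟩ 1 * MonoidAlgebra.single ⟨q, l'⟩ 1 := by
      rw [MonoidAlgebra.single_mul_single]; simp
    have h2 : (MonoidAlgebra.single ⟨p, r :: l⟩ 1 : FreeDiff F I) =
        gen F p * MonoidAlgebra.single ⟨r, l⟩ 1 := by
      rw [gen, MonoidAlgebra.single_mul_single]; simp [FreeSemigroup.of]
    simp only [List.cons_append, derivWord, ih, h1, h2, mul_add, add_mul, mul_assoc]
    abel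

theorem derivFree_mem (f : ℕ × I → FreeDiff F I) : derivFree f ∈ Der F (FreeDiff F I) := by
  intro a b
  induction a using MonoidAlgebra.induction_linear with
  | zero => simp
  | add a₁ a₂ h₁ h₂ => simp only [add_mul, map_add, h₁, h₂]; abel
  | single w c =>
    induction b using MonoidAlgebra.induction_linear with
    | zero => simp
    | add b₁ b₂ h₁ h₂ => simp only [mul_add, map_add, h₁, h₂]; abel
    | single w' c' =>
      have h (w : FreeSemigroup (ℕ × I)) (c : F) : (MonoidAlgebra.single w c : FreeDiff F I) =
          c • MonoidAlgebra.single w 1 := by simp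
      rw [MonoidAlgebra.single_mul_single, derivFree_single, derivFree_single, derivFree_single,
        h w c, h w' c', FreeSemigroup.head_mul, FreeSemigroup.tail_mul, derivWord_append]
      simp only [smul_add, smul_mul_assoc, mul_smul_comm, smul_smul, mul_comm c']

theorem der_ext {D E : Module.End F (FreeDiff F I)} (hD : D ∈ Der F (FreeDiff F I))
    (hE : E ∈ Der F (FreeDiff F I)) (h : ∀ p, D (gen F p) = E (gen F p)) : D = E := by
  have key : ∀ w : FreeSemigroup (ℕ × I),
      D (MonoidAlgebra.single w 1) = E (MonoidAlgebra.single w 1) := by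
    intro w
    induction w with
    | ih1 p => exact h p
    | ih2 p w h₁ h₂ =>
      have : (MonoidAlgebra.single (FreeSemigroup.of p * w) 1 : FreeDiff F I) =
          gen F p * MonoidAlgebra.single w 1 := by
        rw [gen, MonoidAlgebra.single_mul_single, mul_one]
      rw [this, hD, hE, h₂, h p]
  refine LinearMap.ext fun a => ?_
  induction a using MonoidAlgebra.induction_linear with
  | zero => simp
  | add a₁ a₂ h₁ h₂ => simp only [map_add, h₁, h₂]
  | single w c =>
    have : (MonoidAlgebra.single w c : FreeDiff F I) = c • MonoidAlgebra.single w 1 := by simp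
    rw [this, map_smul, map_smul, key]

variable (b : Module.Basis I F (UniversalEnvelopingAlgebra F L))

/-- The element `x_j ^ h` for `h ∈ U(L)`; it is linear in `h`. -/
def xpow (j : ℕ) : UniversalEnvelopingAlgebra F L →ₗ[F] FreeDiff F I :=
  b.constr F fun i => gen F (j, i)

@[simp] theorem xpow_basis (j : ℕ) (i : I) : xpow b j (b i) = gen F (j, i) := by
  simp [xpow]

/-- The action of `L` on the free algebra by derivations, `γ(x_j ^ h) = x_j ^ (γ h)`. -/
def freeAct : L →ₗ⁅F⁆ Der F (FreeDiff F I) where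
  toFun γ := ⟨derivFree fun p => xpow b p.1 (UniversalEnvelopingAlgebra.ι F γ * b p.2),
    derivFree_mem _⟩
  map_add' γ γ' := by
    apply Subtype.ext
    refine der_ext (derivFree_mem _) (add_mem (derivFree_mem _) (derivFree_mem _)) fun p => ?_
    simp [add_mul]
  map_smul' c γ := by
    apply Subtype.ext
    refine der_ext (derivFree_mem _) ((Der F _).smul_mem c (derivFree_mem _)) fun p => ?_
    simp
  map_lie' {γ γ'} := by
    apply Subtype.ext
    refine der_ext (derivFree_mem _)
      ((Der F _).lie_mem (derivFree_mem _) (derivFree_mem _)) fun p => ?_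
    have key : ∀ (γ : L) (j : ℕ) (h : UniversalEnvelopingAlgebra F L),
        derivFree (fun p : ℕ × I => xpow b p.1 (UniversalEnvelopingAlgebra.ι F γ * b p.2))
          (xpow b j h) = xpow b j (UniversalEnvelopingAlgebra.ι F γ * h) := by
      intro γ j h
      have : (derivFree (fun p : ℕ × I =>
            xpow b p.1 (UniversalEnvelopingAlgebra.ι F γ * b p.2))).comp (xpow b j) =
          (xpow b j).comp (LinearMap.mulLeft F (UniversalEnvelopingAlgebra.ι F γ)) := by
        refine b.ext fun i => ?_
        simp
      exact LinearMap.congr_fun this h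
    simp only [LieSubalgebra.coe_bracket, LieRing.of_associative_ring_bracket,
      LinearMap.sub_apply, Module.End.mul_apply, derivFree_gen, key, LieHom.map_lie, sub_mul, map_sub, mul_assoc]

/-- A `T_L`-ideal: a (two-sided) algebra ideal which is invariant under the action of `U(L)` and
under all algebra endomorphisms commuting with this action. -/
structure IsTLIdeal (J : Submodule F (FreeDiff F I)) : Prop where
  mul_mem_left : ∀ f g, g ∈ J → f * g ∈ J
  mul_mem_right : ∀ f g, f ∈ J → f * g ∈ J
  act_mem : ∀ (h : UniversalEnvelopingAlgebra F L) (f), f ∈ J → uAct (freeAct b) h f ∈ J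
  end_mem : ∀ φ : FreeDiff F I →ₙₐ[F] FreeDiff F I,
    (∀ (h : UniversalEnvelopingAlgebra F L) (f),
      φ (uAct (freeAct b) h f) = uAct (freeAct b) h (φ f)) →
    ∀ f, f ∈ J → φ f ∈ J

/-- The `T_L`-ideal `⟨S⟩_{T_L}` generated by a set `S` of differential polynomials. -/
def TLSpan (S : Set (FreeDiff F I)) : Submodule F (FreeDiff F I) :=
  sInf {J | IsTLIdeal b J ∧ S ⊆ J}

/-- The space `P_n^L` of multilinear differential polynomials in the first `n` variables. -/
def multilin (F : Type u) [Field F] (I : Type z) (n : ℕ) : Submodule F (FreeDiff F I) :=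
  Submodule.span F {f | ∃ (w : FreeSemigroup (ℕ × I)) (σ : Equiv.Perm (Fin n)) (h : Fin n → I),
    w.head :: w.tail = List.ofFn (fun k => ((σ k : ℕ), h k)) ∧ f = MonoidAlgebra.single w 1}

/-- Permutations of the variables, `σ(x_j ^ h) = x_{σ(j)} ^ h`, acting by automorphisms. -/
def permVars (F : Type u) [Field F] (I : Type z) :
    Representation F (Equiv.Perm ℕ) (FreeDiff F I) where
  toFun σ := ((subst fun p : ℕ × I => gen F (σ p.1, p.2)) : FreeDiff F I →ₙₐ[F] FreeDiff F I)
  map_one' := by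
    have : (subst fun p : ℕ × I => gen F ((1 : Equiv.Perm ℕ) p.1, p.2)) =
        NonUnitalAlgHom.id F (FreeDiff F I) := hom_ext fun p => by simp
    rw [this]; rfl
  map_mul' σ τ := by
    have : (subst fun p : ℕ × I => gen F ((σ * τ) p.1, p.2)) =
        (subst fun p : ℕ × I => gen F (σ p.1, p.2)).comp
          (subst fun p : ℕ × I => gen F (τ p.1, p.2)) := hom_ext fun p => by simp
    rw [this]; rfl

/-- `S_n` acts on differential polynomials by permuting the first `n` variables. -/
def permFirst (F : Type u) [Field F] (I : Type z) (n : ℕ) :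
    Representation F (Equiv.Perm (Fin n)) (FreeDiff F I) :=
  (permVars F I).comp (Equiv.Perm.viaEmbeddingHom Fin.valEmbedding)

theorem permFirst_gen (n : ℕ) (σ : Equiv.Perm (Fin n)) (k : Fin n) (i : I) :
    permFirst F I n σ (gen F ((k : ℕ), i)) = gen F ((σ k : ℕ), i) := by
  have := Equiv.Perm.viaEmbedding_apply σ Fin.valEmbedding k
  simp only [Fin.valEmbedding_apply] at this
  simp [permFirst, permVars, Equiv.Perm.viaEmbeddingHom_apply, this]

theorem permVars_word (σ : Equiv.Perm ℕ) (w : FreeSemigroup (ℕ × I)) :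
    permVars F I σ (MonoidAlgebra.single w 1) =
      MonoidAlgebra.single (FreeSemigroup.map (fun p => (σ p.1, p.2)) w) 1 := by
  induction w with
  | ih1 p => simp [permVars, subst, gen]
  | ih2 p w h₁ h₂ =>
    have : (MonoidAlgebra.single (FreeSemigroup.of p * w) 1 : FreeDiff F I) =
        gen F p * MonoidAlgebra.single w 1 := by
      rw [gen, MonoidAlgebra.single_mul_single, mul_one]
    have hm (f g : FreeDiff F I) : permVars F I σ (f * g) = permVars F I σ f * permVars F I σ g :=
      map_mul (subst fun p : ℕ × I => gen F (σ p.1, p.2)) f g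
    rw [this, hm, h₂, gen, h₁, MonoidAlgebra.single_mul_single, map_mul, mul_one]

theorem map_toList {α β : Type*} (f : α → β) (w : FreeSemigroup α) :
    (FreeSemigroup.map f w).head :: (FreeSemigroup.map f w).tail = (w.head :: w.tail).map f := by
  induction w with
  | ih1 p => rfl
  | ih2 p w h₁ h₂ =>
    rw [map_mul, FreeSemigroup.map_of, FreeSemigroup.head_mul, FreeSemigroup.tail_mul, h₂]
    rfl

theorem multilin_invariant (n : ℕ) (σ : Equiv.Perm (Fin n)) :
    multilin F I n ≤ (multilin F I n).comap (permFirst F I n σ) := by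
  rw [multilin, Submodule.span_le]
  rintro _ ⟨w, τ, h, hw, rfl⟩
  refine Submodule.subset_span ⟨_, σ * τ, h, ?_, permVars_word _ w⟩
  rw [map_toList, hw, List.map_ofFn]
  congr 1
  funext k
  have := Equiv.Perm.viaEmbedding_apply σ Fin.valEmbedding (τ k)
  simp only [Fin.valEmbedding_apply] at this
  simp [Equiv.Perm.viaEmbeddingHom_apply, this]

end Free

/-! ### Differential identities, codimensions and cocharacters -/

section Identities

variable {F : Type u} [Field F]
variable {L : Type w} [LieRing L] [LieAlgebra F L]
variable {I : Type z} (b : Module.Basis I F (UniversalEnvelopingAlgebra F L))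
variable {A : Type v} [NonUnitalRing A] [Module F A] [IsScalarTower F A A] [SMulCommClass F A A]
variable (ρ : L →ₗ⁅F⁆ Der F A)

/-- Evaluation of differential polynomials at `x_j = a j`, so that `x_j ^ h` becomes `h(a j)`. -/
def evalAt (a : ℕ → A) : FreeDiff F I →ₙₐ[F] A :=
  subst fun p => uAct ρ (b p.2) (a p.1)

/-- The space `Id^L(A)` of differential identities of the `L`-algebra `A`. -/
def IdL : Submodule F (FreeDiff F I) where
  carrier := {f | ∀ a : ℕ → A, evalAt b ρ a f = 0}
  add_mem' := by
    intro f g hf hg a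
    rw [map_add, hf a, hg a, add_zero]
  zero_mem' := fun a => map_zero _
  smul_mem' := by
    intro c f hf a
    rw [map_smul, hf a, smul_zero]

theorem IdL_invariant (n : ℕ) (σ : Equiv.Perm (Fin n)) :
    IdL b ρ ≤ (IdL b ρ).comap (permFirst F I n σ) := by
  intro f hf a
  have : (evalAt b ρ a).comp
      (subst fun p : ℕ × I => gen F (σ.viaEmbedding Fin.valEmbedding p.1, p.2)) =
      evalAt b ρ (fun j => a (σ.viaEmbedding Fin.valEmbedding j)) :=
    hom_ext fun p => by simp [evalAt]
  exact (DFunLike.congr_fun this f).trans (hf _)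

/-- `P_n^L ∩ Id^L(A)` as a subspace of `P_n^L`. -/
def multilinId (n : ℕ) : Submodule F (multilin F I n) :=
  (IdL b ρ).comap (multilin F I n).subtype

/-- The `n`th differential codimension `c_n^L(A) = dim P_n^L / (P_n^L ∩ Id^L(A))`. -/
def codim (n : ℕ) : ℕ :=
  Module.finrank F (multilin F I n ⧸ multilinId b ρ n)

/-- The `S_n`-module `P_n^L(A) = P_n^L / (P_n^L ∩ Id^L(A))`. -/
def relFreeRep (n : ℕ) :
    Representation F (Equiv.Perm (Fin n)) (multilin F I n ⧸ multilinId b ρ n) :=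
  ((permFirst F I n).subrepresentation (multilin F I n) (multilin_invariant n)).quotient
    (multilinId b ρ n) fun σ _ hf => IdL_invariant b ρ n σ hf

/-- The `n`th differential cocharacter `χ_n^L(A)`. -/
def cochar (n : ℕ) : Equiv.Perm (Fin n) → F :=
  (relFreeRep b ρ n).character

/-- The differential polynomials `x[y,z]`, `x^δ y - y^δ x`, `x y^δ`, `x^{δ²}`, for `d ∈ L` in the
role of `δ`. -/
def gens₁ (d : L) : Set (FreeDiff F I) :=
  let x := xpow b 0
  let y := xpow b 1
  let z := xpow b 2
  let δ := UniversalEnvelopingAlgebra.ι F d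
  {x 1 * (y 1 * z 1 - z 1 * y 1), x δ * y 1 - y δ * x 1, x 1 * y δ, x (δ ^ 2)}

/-- The differential polynomials `[x,y]z`, `x y^δ - y x^δ`, `x^δ y`, `x^{δ²}`, for `d ∈ L` in the
role of `δ`. -/
def gens₂ (d : L) : Set (FreeDiff F I) :=
  let x := xpow b 0
  let y := xpow b 1
  let z := xpow b 2
  let δ := UniversalEnvelopingAlgebra.ι F d
  {(x 1 * y 1 - y 1 * x 1) * z 1, x 1 * y δ - y 1 * x δ, x δ * y 1, x (δ ^ 2)}

/-- The differential polynomials `x ^ γ` for the elements `γ` of `L` acting trivially. -/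
def trivGens : Set (FreeDiff F I) :=
  {f | ∃ γ : L, ρ γ = 0 ∧ f = xpow b 0 (UniversalEnvelopingAlgebra.ι F γ)}

end Identities

/-! ### Irreducible characters of the symmetric group -/

section Specht

/-- The permutation action of `S_n` on row functions: a tabloid is recorded by the function
sending each number to the index of its row. -/
def tabloidRep (F : Type u) [Field F] (n : ℕ) :
    Representation F (Equiv.Perm (Fin n)) ((Fin n → ℕ) →₀ F) where
  toFun σ := Finsupp.lmapDomain F F fun r k => r (σ⁻¹ k)
  map_one' := by ext; simp
  map_mul' σ τ := by ext; simp

variable {n : ℕ} {μ : YoungDiagram}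

/-- The tabloid of a Young tableau `t`, where `t k` is the cell containing the number `k`. -/
def tabloid (t : Fin n ≃ μ.cells) : Fin n → ℕ := fun k => (t k : ℕ × ℕ).1

open scoped Classical in
/-- The polytabloid of a tableau `t`: the signed sum of the tabloids of `σ t`, over the
permutations `σ` preserving the columns of `t`. -/
def polytabloid (F : Type u) [Field F] (t : Fin n ≃ μ.cells) : (Fin n → ℕ) →₀ F :=
  ∑ σ : Equiv.Perm (Fin n) with ∀ k, (t (σ k) : ℕ × ℕ).2 = (t k : ℕ × ℕ).2,
    ((Equiv.Perm.sign σ : ℤ) : F) • tabloidRep F n σ (Finsupp.single (tabloid t) 1)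

/-- The Specht module of shape `μ`: the span of the polytabloids of all tableaux of shape `μ`. -/
def specht (F : Type u) [Field F] (n : ℕ) (μ : YoungDiagram) : Submodule F ((Fin n → ℕ) →₀ F) :=
  Submodule.span F (Set.range fun t : Fin n ≃ μ.cells => polytabloid F t)

theorem tabloidRep_tabloid (F : Type u) [Field F] (σ : Equiv.Perm (Fin n)) (t : Fin n ≃ μ.cells) :
    tabloidRep F n σ (Finsupp.single (tabloid t) 1) =
      Finsupp.single (tabloid (σ⁻¹.trans t)) 1 := by
  simp [tabloidRep]
  rfl

theorem tabloidRep_polytabloid (F : Type u) [Field F] (σ : Equiv.Perm (Fin n))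
    (t : Fin n ≃ μ.cells) :
    tabloidRep F n σ (polytabloid F t) = polytabloid F (σ⁻¹.trans t) := by
  classical
  simp only [polytabloid, map_sum, map_smul]
  refine Finset.sum_bij (fun τ _ => σ * τ * σ⁻¹) ?_ ?_ ?_ ?_
  · intro τ hτ
    simp only [Finset.mem_filter, Finset.mem_univ, true_and] at hτ ⊢
    intro k
    simpa using hτ (σ⁻¹ k)
  · intro τ _ τ' _ h
    simpa using h
  · intro τ hτ
    simp only [Finset.mem_filter, Finset.mem_univ, true_and] at hτ
    refine ⟨σ⁻¹ * τ * σ, ?_, by simp [mul_assoc]⟩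
    simp only [Finset.mem_filter, Finset.mem_univ, true_and]
    intro k
    simpa using hτ (σ k)
  · intro τ _
    rw [← tabloidRep_tabloid, ← Module.End.mul_apply, ← map_mul, ← Module.End.mul_apply,
      ← map_mul]
    congr 1
    · rcases Int.units_eq_one_or (Equiv.Perm.sign σ) with h | h <;> simp [h]
    · simp [mul_assoc]

theorem specht_invariant (F : Type u) [Field F] (n : ℕ) (μ : YoungDiagram)
    (σ : Equiv.Perm (Fin n)) : specht F n μ ≤ (specht F n μ).comap (tabloidRep F n σ) := by
  rw [specht, Submodule.span_le]
  rintro _ ⟨t, rfl⟩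
  exact Submodule.subset_span ⟨_, (tabloidRep_polytabloid F σ t).symm⟩

/-- The irreducible `S_n`-character `χ_μ` of a partition `μ` of `n`. -/
def spechtChar (F : Type u) [Field F] (n : ℕ) (μ : YoungDiagram) : Equiv.Perm (Fin n) → F :=
  Representation.character (V := specht F n μ)
    ((tabloidRep F n).subrepresentation (specht F n μ) (specht_invariant F n μ))

/-- The partition `(n)`. -/
def oneRow (n : ℕ) : YoungDiagram := YoungDiagram.ofRowLens [n] (List.Pairwise.sortedGE (by simp))

/-- The partition `(n - 1, 1)` of `n ≥ 2`. -/
def hook (n : ℕ) (hn : 2 ≤ n) : YoungDiagram :=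
  YoungDiagram.ofRowLens [n - 1, 1] (List.Pairwise.sortedGE (by simp; omega))

end Specht

/-! ### The algebras `M₁`, `M₂` and the derivation `δ`

Rows and columns of `2 × 2` matrices are numbered `0, 1`, so that `e₁₁`, `e₁₂`, `e₂₂` are
the matrix units at `(0, 0)`, `(0, 1)`, `(1, 1)`. -/

section Algebras

variable (F : Type u) [Field F]

/-- The algebra `M₁ = F e₂₂ ⊕ F e₁₂`. -/
def M₁ : NonUnitalSubalgebra F (Matrix (Fin 2) (Fin 2) F) where
  carrier := {m | ∃ α β : F, m = α • Matrix.single 1 1 1 + β • Matrix.single 0 1 1}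
  add_mem' := by
    rintro _ _ ⟨α, β, rfl⟩ ⟨α', β', rfl⟩
    exact ⟨α + α', β + β', by simp only [add_smul]; abel⟩
  zero_mem' := ⟨0, 0, by simp⟩
  mul_mem' := by
    rintro _ _ ⟨α, β, rfl⟩ ⟨α', β', rfl⟩
    refine ⟨α * α', β * α', ?_⟩
    ext i j
    fin_cases i <;> fin_cases j <;> simp [Matrix.mul_apply, Matrix.single_apply]
  smul_mem' := by
    rintro c _ ⟨α, β, rfl⟩
    exact ⟨c * α, c * β, by simp only [smul_add, smul_smul]⟩

/-- The algebra `M₂ = F e₁₁ ⊕ F e₁₂`. -/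
def M₂ : NonUnitalSubalgebra F (Matrix (Fin 2) (Fin 2) F) where
  carrier := {m | ∃ α β : F, m = α • Matrix.single 0 0 1 + β • Matrix.single 0 1 1}
  add_mem' := by
    rintro _ _ ⟨α, β, rfl⟩ ⟨α', β', rfl⟩
    exact ⟨α + α', β + β', by simp only [add_smul]; abel⟩
  zero_mem' := ⟨0, 0, by simp⟩
  mul_mem' := by
    rintro _ _ ⟨α, β, rfl⟩ ⟨α', β', rfl⟩
    refine ⟨α * α', α * β', ?_⟩
    ext i j
    fin_cases i <;> fin_cases j <;> simp [Matrix.mul_apply, Matrix.single_apply]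
  smul_mem' := by
    rintro c _ ⟨α, β, rfl⟩
    exact ⟨c * α, c * β, by simp only [smul_add, smul_smul]⟩

/-- The derivation `δ(α e₂₂ + β e₁₂) = α e₁₂` of `M₁`. -/
def δ₁ : Der F (M₁ F) where
  val :=
    { toFun := fun m => ⟨(m : Matrix (Fin 2) (Fin 2) F) 1 1 • Matrix.single 0 1 1, 0, _,
        by rw [zero_smul, zero_add]⟩
      map_add' := fun m m' => Subtype.ext (by simp [add_smul])
      map_smul' := fun c m => Subtype.ext (by simp) }
  property := by
    rintro ⟨_, α, β, rfl⟩ ⟨_, α', β', rfl⟩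
    apply Subtype.ext
    ext i j
    fin_cases i <;> fin_cases j <;> simp [Matrix.mul_apply, Matrix.single_apply]

/-- The derivation `δ(α e₁₁ + β e₁₂) = α e₁₂` of `M₂`. -/
def δ₂ : Der F (M₂ F) where
  val :=
    { toFun := fun m => ⟨(m : Matrix (Fin 2) (Fin 2) F) 0 0 • Matrix.single 0 1 1, 0, _,
        by rw [zero_smul, zero_add]⟩
      map_add' := fun m m' => Subtype.ext (by simp [add_smul])
      map_smul' := fun c m => Subtype.ext (by simp) }
  property := by
    rintro ⟨_, α, β, rfl⟩ ⟨_, α', β', rfl⟩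
    apply Subtype.ext
    ext i j
    fin_cases i <;> fin_cases j <;> simp [Matrix.mul_apply, Matrix.single_apply]

end Algebras

end DiffId

end

noncomputable section

namespace DiffId

universe u v w z

/-! ### Evaluation, substitution and reduction of exponents modulo a T_L-ideal -/

section General

variable {F : Type u} [Field F]
variable {L : Type w} [LieRing L] [LieAlgebra F L]
variable {I : Type z}

/-! Write an element of `M₁` as a pair (s, t) of its coefficients at e₂₂ and e₁₂. Then (s, t)(s',
t') = (s s', t s') and δ(s, t) = (0, s). Since δ² = 0 and L acts through Fδ, every h in U(L) acts as
c₀(h) + c₁(h)δ. So the word x_{j₁}^{h₁} ⋯ x_{jₙ}^{hₙ} has e₁₂-coefficient (c₀(h₁) t_{j₁} + c₁(h₁)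
s_{j₁}) ∏_{k ≥ 2} c₀(h_k) s_{j_k}. This is a combination of two monomials in the s and t, and
`normalForm` records it formally.

The identities are then squeezed by a cycle of inclusions. The T_L-ideal of the proposed generators
consists of identities. An identity has normal form zero, because distinct normal monomials are
distinct monomials in s and t and a polynomial vanishing everywhere over an infinite field is zero
(`evalMon_separates`). Finally, the generators suffice to rewrite every word into its normal form:
`exists_coeff` reduces the exponents to 1 and δ, and `ker_normalForm_le` reorders the letters and
discards δ beyond the first one.

The product of `M₂` is (s s', s t'), opposite to that of `M₁`, with the same δ. The same normal form
therefore serves after reversing words.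

In degree n the multilinear normal monomials are x_j ∏_{k ≠ j} x_k for each j and a single one
containing δ. They form a basis of the relatively free module with n + 1 elements, which S_n
permutes with one fixed point and one copy of the natural action (`codim_cochar_of_normalForm`). The
character is 1 + fix(σ). The Specht module of (n) is trivial and that of (n - 1, 1) is the sum-zero
part of the natural permutation module, so their characters are 1 and fix(σ) - 1. -/

theorem envelopingAlgebra_induction {P : UniversalEnvelopingAlgebra F L → Prop}
    (one : P 1) (ι_mul : ∀ γ h, P h → P (UniversalEnvelopingAlgebra.ι F γ * h))
    (add : ∀ h h', P h → P h' → P (h + h')) (smul : ∀ (c : F) h, P h → P (c • h)) (h) : P h := by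
  let S : Subalgebra F (UniversalEnvelopingAlgebra F L) :=
    Algebra.adjoin F (Set.range (UniversalEnvelopingAlgebra.ι F))
  have hS : ∀ x, x ∈ S := by
    intro x
    let f : L →ₗ⁅F⁆ S :=
      { toFun := fun γ => ⟨UniversalEnvelopingAlgebra.ι F γ, Algebra.subset_adjoin ⟨γ, rfl⟩⟩
        map_add' := fun γ γ' => Subtype.ext (map_add _ _ _)
        map_smul' := fun c γ => Subtype.ext (map_smul _ _ _)
        map_lie' := fun {γ γ'} => Subtype.ext (LieHom.map_lie _ _ _) }
    -- By the universal property, the corestriction of ι to `S` followed by the inclusion is the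
    -- identity of U(L), which forces `S` to be everything.
    have : S.val.comp (UniversalEnvelopingAlgebra.lift F f) = AlgHom.id F _ := by
      apply UniversalEnvelopingAlgebra.hom_ext
      ext γ
      have := UniversalEnvelopingAlgebra.lift_ι_apply F f γ
      exact congrArg Subtype.val this
    rw [← AlgHom.id_apply (R := F) x, ← this]
    exact (UniversalEnvelopingAlgebra.lift F f x).2
  have key : ∀ x ∈ S, ∀ h, P h → P (x * h) := by
    intro x hx
    induction hx using Algebra.adjoin_induction with
    | mem x hx => obtain ⟨γ, rfl⟩ := hx; exact ι_mul γ
    | algebraMap c => intro h hh; rw [← Algebra.smul_def]; exact smul c h hh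
    | add x y _ _ hx hy => intro h hh; rw [add_mul]; exact add _ _ (hx h hh) (hy h hh)
    | mul x y _ _ hx hy => intro h hh; rw [mul_assoc]; exact hx _ (hy h hh)
  simpa using key h (hS h) 1 one

theorem freeDiff_induction {P : FreeDiff F I → Prop} (zero : P 0) (gen : ∀ p, P (gen F p))
    (mul : ∀ p f, P f → P (DiffId.gen F p * f)) (add : ∀ f g, P f → P g → P (f + g))
    (smul : ∀ (c : F) f, P f → P (c • f)) (f) : P f := by
  induction f using MonoidAlgebra.induction_linear with
  | zero => exact zero
  | add f g hf hg => exact add f g hf hg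
  | single w c =>
    have hw : P (MonoidAlgebra.single w 1) := by
      induction w with
      | ih1 p => exact gen p
      | ih2 p w h₁ h₂ =>
        have : (MonoidAlgebra.single (FreeSemigroup.of p * w) 1 : FreeDiff F I) =
            DiffId.gen F p * MonoidAlgebra.single w 1 := by
          rw [DiffId.gen, MonoidAlgebra.single_mul_single, mul_one]
        rw [this]
        exact mul p _ h₂
    have h : (MonoidAlgebra.single w c : FreeDiff F I) = c • MonoidAlgebra.single w 1 := by simp
    rw [h]
    exact smul c _ hw

theorem uAct_ι {A : Type v} [NonUnitalRing A] [Module F A] [IsScalarTower F A A]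
    [SMulCommClass F A A] (ρ : L →ₗ⁅F⁆ Der F A) (γ : L) :
    uAct ρ (UniversalEnvelopingAlgebra.ι F γ) = (ρ γ : Module.End F A) :=
  UniversalEnvelopingAlgebra.lift_ι_apply F _ γ

variable (b : Module.Basis I F (UniversalEnvelopingAlgebra F L))

theorem freeAct_xpow (γ : L) (j : ℕ) (h : UniversalEnvelopingAlgebra F L) :
    (freeAct b γ : Module.End F (FreeDiff F I)) (xpow b j h) =
      xpow b j (UniversalEnvelopingAlgebra.ι F γ * h) := by
  have : ((freeAct b γ : Module.End F (FreeDiff F I))).comp (xpow b j) =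
      (xpow b j).comp (LinearMap.mulLeft F (UniversalEnvelopingAlgebra.ι F γ)) := by
    refine b.ext fun i => ?_
    simp [freeAct]
  exact LinearMap.congr_fun this h

theorem uAct_xpow (h : UniversalEnvelopingAlgebra F L) (j : ℕ) :
    uAct (freeAct b) h (xpow b j 1) = xpow b j h := by
  induction h using envelopingAlgebra_induction with
  | one => simp
  | ι_mul γ h ih => rw [map_mul, Module.End.mul_apply, ih, uAct_ι, freeAct_xpow]
  | add h h' ih ih' => simp [ih, ih']
  | smul c h ih => simp [ih]

variable {A : Type v} [NonUnitalRing A] [Module F A] [IsScalarTower F A A] [SMulCommClass F A A]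
variable (ρ : L →ₗ⁅F⁆ Der F A)

theorem evalAt_xpow (a : ℕ → A) (j : ℕ) (h : UniversalEnvelopingAlgebra F L) :
    evalAt b ρ a (xpow b j h) = uAct ρ h (a j) := by
  have : (evalAt b ρ a : FreeDiff F I →ₗ[F] A).comp (xpow b j) =
      (LinearMap.applyₗ (a j)).comp (uAct ρ).toLinearMap := by
    refine b.ext fun i => ?_
    simp [evalAt]
  exact LinearMap.congr_fun this h

/-- Both sides obey the same Leibniz rule along the evaluation, so agreement on generators is
enough. -/
theorem evalAt_freeAct (a : ℕ → A) (γ : L) (f : FreeDiff F I) :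
    evalAt b ρ a ((freeAct b γ : Module.End F (FreeDiff F I)) f) =
      (ρ γ : Module.End F A) (evalAt b ρ a f) := by
  have hg : ∀ p, evalAt b ρ a ((freeAct b γ : Module.End F (FreeDiff F I)) (gen F p)) =
      (ρ γ : Module.End F A) (evalAt b ρ a (gen F p)) := by
    rintro ⟨j, i⟩
    rw [← xpow_basis b, freeAct_xpow, evalAt_xpow, evalAt_xpow, map_mul, uAct_ι,
      Module.End.mul_apply]
  induction f using freeDiff_induction with
  | zero => simp
  | gen p => exact hg p
  | mul p f ih =>
    have h1 := (freeAct b γ).2 (gen F p) f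
    have h2 := (ρ γ).2 (evalAt b ρ a (gen F p)) (evalAt b ρ a f)
    rw [h1, map_add, map_mul, map_mul, map_mul, h2, ih, hg]
  | add f g hf hg => simp [hf, hg]
  | smul c f hf => simp [hf]

theorem evalAt_uAct (a : ℕ → A) (h : UniversalEnvelopingAlgebra F L) (f : FreeDiff F I) :
    evalAt b ρ a (uAct (freeAct b) h f) = uAct ρ h (evalAt b ρ a f) := by
  induction h using envelopingAlgebra_induction with
  | one => simp
  | ι_mul γ h ih =>
    rw [map_mul, Module.End.mul_apply, uAct_ι, evalAt_freeAct, ih, map_mul, Module.End.mul_apply,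
      uAct_ι]
  | add h h' ih ih' => simp [ih, ih']
  | smul c h ih => simp [ih]

theorem isTLIdeal_IdL : IsTLIdeal b (IdL b ρ) where
  mul_mem_left f g hg a := by rw [map_mul, hg a, mul_zero]
  mul_mem_right f g hf a := by rw [map_mul, hf a, zero_mul]
  act_mem h f hf a := by rw [evalAt_uAct, hf a, map_zero]
  end_mem φ hφ f hf a := by
    -- An equivariant endomorphism followed by an evaluation is again an evaluation, at the values
    -- of the images of the x_j.
    have : (evalAt b ρ a).comp φ = evalAt b ρ fun j => evalAt b ρ a (φ (xpow b j 1)) := by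
      refine hom_ext fun ⟨j, i⟩ => ?_
      rw [NonUnitalAlgHom.comp_apply, ← xpow_basis b, evalAt_xpow, ← uAct_xpow, hφ, evalAt_uAct]
    exact (DFunLike.congr_fun this f).trans (hf _)

theorem isTLIdeal_TLSpan (S : Set (FreeDiff F I)) : IsTLIdeal b (TLSpan b S) where
  mul_mem_left f g hg := (Submodule.mem_sInf).2 fun J hJ =>
    hJ.1.mul_mem_left f g (Submodule.mem_sInf.1 hg J hJ)
  mul_mem_right f g hg := (Submodule.mem_sInf).2 fun J hJ =>
    hJ.1.mul_mem_right f g (Submodule.mem_sInf.1 hg J hJ)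
  act_mem h f hg := (Submodule.mem_sInf).2 fun J hJ =>
    hJ.1.act_mem h f (Submodule.mem_sInf.1 hg J hJ)
  end_mem φ hφ f hg := (Submodule.mem_sInf).2 fun J hJ =>
    hJ.1.end_mem φ hφ f (Submodule.mem_sInf.1 hg J hJ)

theorem subset_TLSpan (S : Set (FreeDiff F I)) : S ⊆ TLSpan b S := fun _ hf =>
  Submodule.mem_sInf.2 fun _ hJ => hJ.2 hf

theorem TLSpan_le {S : Set (FreeDiff F I)} {J : Submodule F (FreeDiff F I)} (hJ : IsTLIdeal b J)
    (h : S ⊆ J) : TLSpan b S ≤ J :=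
  sInf_le ⟨hJ, h⟩

variable {b} in
-- Evaluation in the free algebra itself is an endomorphism commuting with U(L), so arbitrary
-- differential polynomials may be substituted for the variables of a member of J.
theorem IsTLIdeal.evalAt_mem {J : Submodule F (FreeDiff F I)} (hJ : IsTLIdeal b J)
    (g : ℕ → FreeDiff F I) {f : FreeDiff F I} (hf : f ∈ J) : evalAt b (freeAct b) g f ∈ J :=
  hJ.end_mem _ (fun h f => evalAt_uAct b (freeAct b) g h f) f hf

/-- Modulo a `T_L`-ideal containing `x^{δ²}` and the `x^γ` with `γ` acting trivially, the
generators `x_j^h` are linear combinations of `x_j` and `x_j^δ`. -/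
theorem exists_coeff {J : Submodule F (FreeDiff F I)} (hJ : IsTLIdeal b J) (d : L)
    (hρ : ∀ γ : L, ∃ c : F, ρ γ = c • ρ d) (htriv : trivGens b ρ ⊆ J)
    (hsq : xpow b 0 (UniversalEnvelopingAlgebra.ι F d ^ 2) ∈ J) (hJρ : J ≤ IdL b ρ) :
    ∃ c₀ c₁ : I → F, (∀ i a, uAct ρ (b i) a = c₀ i • a + c₁ i • (ρ d : Module.End F A) a) ∧
      ∀ j i, gen F (j, i) - (c₀ i • xpow b j 1 + c₁ i • xpow b j (UniversalEnvelopingAlgebra.ι F d))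
        ∈ J := by
  -- Exponents in J may be multiplied on the right, by substituting x_j^{h'} for the variable, and
  -- on the left (`hleft`), by acting with U(L).
  have hsub : ∀ h, xpow b 0 h ∈ J → ∀ j h', xpow b j (h * h') ∈ J := by
    intro h hh j h'
    have := hJ.evalAt_mem (fun _ => xpow b j h') hh
    rwa [evalAt_xpow, ← uAct_xpow b h', ← Module.End.mul_apply, ← map_mul, uAct_xpow] at this
  have hleft : ∀ h j h', xpow b j h ∈ J → xpow b j (h' * h) ∈ J := by
    intro h j h' hh
    have := hJ.act_mem h' _ hh
    rwa [← uAct_xpow b h, ← Module.End.mul_apply, ← map_mul, uAct_xpow] at this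
  have main : ∀ h, ∃ c₀ c₁ : F, ∀ j, xpow b j (h - (c₀ • 1 + c₁ • UniversalEnvelopingAlgebra.ι F d))
      ∈ J := by
    intro h
    induction h using envelopingAlgebra_induction with
    | one => exact ⟨1, 0, by simp⟩
    | ι_mul γ h ih =>
      obtain ⟨c₀, c₁, ih⟩ := ih
      obtain ⟨c, hc⟩ := hρ γ
      have hγ : xpow b 0 (UniversalEnvelopingAlgebra.ι F (γ - c • d)) ∈ J :=
        htriv ⟨γ - c • d, by rw [map_sub, map_smul, hc, sub_self], rfl⟩
      -- Modulo J the exponent γ may be replaced by cδ, and cδ(c₀ + c₁δ) = c c₀ δ + c c₁ δ² with δ²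
      -- dropping out. The three terms `h1`, `h2`, `h3` are the corresponding corrections.
      refine ⟨0, c₀ * c, fun j => ?_⟩
      have h1 := hleft _ j (UniversalEnvelopingAlgebra.ι F γ) (ih j)
      have h2 := hsub _ hγ j (c₀ • 1 + c₁ • UniversalEnvelopingAlgebra.ι F d)
      have h3 := J.smul_mem (c * c₁) (hsub _ hsq j 1)
      rw [← map_smul] at h3
      have h4 := add_mem (add_mem h1 h2) h3
      rw [← map_add, ← map_add] at h4
      convert h4 using 2
      simp only [map_sub, map_smul, mul_sub, sub_mul, mul_add, mul_smul_comm, smul_mul_assoc,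
        mul_one, pow_two]
      module
    | add h h' ih ih' =>
      obtain ⟨c₀, c₁, ih⟩ := ih
      obtain ⟨c₀', c₁', ih'⟩ := ih'
      refine ⟨c₀ + c₀', c₁ + c₁', fun j => ?_⟩
      have := add_mem (ih j) (ih' j)
      rw [← map_add] at this
      convert this using 2
      simp only [add_smul]
      abel
    | smul c h ih =>
      obtain ⟨c₀, c₁, ih⟩ := ih
      refine ⟨c * c₀, c * c₁, fun j => ?_⟩
      have := J.smul_mem c (ih j)
      rw [← map_smul] at this
      convert this using 2
      simp only [smul_sub, smul_add, smul_smul]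
  choose C₀ C₁ hC using main
  have hC' : ∀ j i, gen F (j, i) - (C₀ (b i) • xpow b j 1 +
      C₁ (b i) • xpow b j (UniversalEnvelopingAlgebra.ι F d)) ∈ J := by
    intro j i
    simpa using hC (b i) j
  refine ⟨fun i => C₀ (b i), fun i => C₁ (b i), fun i a => ?_, hC'⟩
  -- Members of J are identities, so evaluating the congruence at a shows that the same coefficients
  -- describe the action on A.
  have := hJρ (hC' 0 i) fun _ => a
  rw [map_sub, map_add, map_smul, map_smul, ← xpow_basis b, evalAt_xpow, evalAt_xpow, evalAt_xpow,
    sub_eq_zero, uAct_ι] at this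
  simpa using this

end General

/-! ### Normal forms of differential polynomials -/

section NormalForm

variable {F : Type u} [Field F] {I : Type z}

/-- The index set of the normal monomials: `inl (j, m)` stands for `x_j` followed by the variables
of `m` in any order, and `inr M` for the product of the variables of `M` in any order, with `δ`
applied to the first one. -/
abbrev NormalMon : Type := (ℕ × Multiset ℕ) ⊕ Multiset ℕ

/-- The normal form of a word when `x_j^{h_i}` acts as `c₀ i • x_j + c₁ i • x_j^δ`. -/
def normalWord (c₀ c₁ : I → F) (p : ℕ × I) (l : List (ℕ × I)) : NormalMon →₀ F :=
  (l.map fun q => c₀ q.2).prod •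
    (c₀ p.2 • Finsupp.single (Sum.inl (p.1, (↑(l.map Prod.fst) : Multiset ℕ))) (1 : F) +
      c₁ p.2 • Finsupp.single (Sum.inr (↑(p.1 :: l.map Prod.fst) : Multiset ℕ)) (1 : F))

/-- The normal form of a differential polynomial. -/
def normalForm (c₀ c₁ : I → F) : FreeDiff F I →ₗ[F] NormalMon →₀ F :=
  (Finsupp.linearCombination F fun w : FreeSemigroup (ℕ × I) =>
    normalWord c₀ c₁ w.head w.tail).comp (MonoidAlgebra.coeffLinearEquiv F).toLinearMap

theorem normalForm_single (c₀ c₁ : I → F) (w : FreeSemigroup (ℕ × I)) :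
    normalForm c₀ c₁ (MonoidAlgebra.single w 1) = normalWord c₀ c₁ w.head w.tail := by
  simp [normalForm]

theorem freeDiff_linearMap_ext {V : Type*} [AddCommGroup V] [Module F V]
    {φ ψ : FreeDiff F I →ₗ[F] V}
    (h : ∀ w, φ (MonoidAlgebra.single w 1) = ψ (MonoidAlgebra.single w 1)) : φ = ψ := by
  refine LinearMap.ext fun f => ?_
  induction f using MonoidAlgebra.induction_linear with
  | zero => simp
  | add f g hf hg => simp [hf, hg]
  | single w c =>
    have hw : (MonoidAlgebra.single w c : FreeDiff F I) = c • MonoidAlgebra.single w 1 := by simp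
    rw [hw, map_smul, map_smul, h]

/-- Building a word by right multiplications matches the structure of `M₁`, where the first letter
is distinguished and each later one only rescales. -/
theorem single_eq_foldl (p : ℕ × I) (l : List (ℕ × I)) :
    (MonoidAlgebra.single ⟨p, l⟩ 1 : FreeDiff F I) =
      l.foldl (fun f q => f * gen F q) (gen F p) := by
  induction l using List.reverseRecOn with
  | nil => rfl
  | append_singleton l q ih =>
    rw [List.foldl_append, ← ih, List.foldl_cons, List.foldl_nil, gen,
      MonoidAlgebra.single_mul_single, mul_one]
    rfl

/-! ### Evaluation of normal forms -/

/-- Evaluation of normal monomials at `x_j = (s j, t j)`. -/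
def evalMon (s t : ℕ → F) : (NormalMon →₀ F) →ₗ[F] F :=
  Finsupp.linearCombination F
    (Sum.elim (fun q => t q.1 * (q.2.map s).prod) fun M => (M.map s).prod)

/-- The multiset of the variables of a polynomial ring which occur in a normal monomial. -/
def monVars : NormalMon → Multiset (ℕ ⊕ ℕ) :=
  Sum.elim (fun q => Sum.inr q.1 ::ₘ q.2.map Sum.inl) fun M => M.map Sum.inl

/-- The s-letters (`Sum.inl`) and the t-letter (`Sum.inr`) can be filtered out separately. The
presence of a t-letter tells the two kinds of monomial apart. -/
theorem monVars_injective : Function.Injective monVars := by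
  have h1 : ∀ m : Multiset ℕ, (m.map (Sum.inl : ℕ → ℕ ⊕ ℕ)).filterMap Sum.getLeft? = m := by
    intro m
    rw [Multiset.filterMap_map]
    exact Multiset.filterMap_some m
  have h2 : ∀ m : Multiset ℕ, (m.map (Sum.inl : ℕ → ℕ ⊕ ℕ)).filterMap Sum.getRight? = 0 := by
    intro m
    rw [Multiset.filterMap_map]
    induction m using Multiset.induction_on with
    | empty => rfl
    | cons a m ih => rw [Multiset.filterMap_cons_none _ _ rfl, ih]
  have hl : ∀ q : NormalMon, (monVars q).filterMap Sum.getLeft? = Sum.elim Prod.snd id q := by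
    rintro (⟨j, m⟩ | M)
    · simp only [monVars, Sum.elim_inl]
      rw [Multiset.filterMap_cons_none _ _ rfl, h1]
    · exact h1 M
  have hr : ∀ q : NormalMon, (monVars q).filterMap Sum.getRight? =
      Sum.elim (fun q => {q.1}) (fun _ => 0) q := by
    rintro (⟨j, m⟩ | M)
    · simp only [monVars, Sum.elim_inl]
      rw [Multiset.filterMap_cons_some Sum.getRight? _ _ rfl, h2]
      rfl
    · exact h2 M
  intro q q' h
  have hL := (hl q).symm.trans ((congrArg _ h).trans (hl q'))
  have hR := (hr q).symm.trans ((congrArg _ h).trans (hr q'))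
  rcases q with ⟨j, m⟩ | M <;> rcases q' with ⟨j', m'⟩ | M' <;> simp_all

theorem eval_monomial_toFinsupp {σ : Type*} [DecidableEq σ] (v : σ → F) (M : Multiset σ) :
    MvPolynomial.eval v (MvPolynomial.monomial (Multiset.toFinsupp M) 1) = (M.map v).prod := by
  induction M using Multiset.induction_on with
  | empty => simp
  | cons a M ih =>
    have : (MvPolynomial.monomial (Multiset.toFinsupp (a ::ₘ M)) (1 : F)) =
        MvPolynomial.X a * MvPolynomial.monomial (Multiset.toFinsupp M) 1 := by
      rw [← Multiset.singleton_add, map_add, Multiset.toFinsupp_singleton, MvPolynomial.X,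
        MvPolynomial.monomial_mul, mul_one]
    rw [this, map_mul, ih, MvPolynomial.eval_X, Multiset.map_cons, Multiset.prod_cons]

/-- By `monVars_injective` the normal monomials embed into the monomial basis of a polynomial ring,
where a polynomial with all values zero over an infinite field vanishes. -/
theorem evalMon_separates [Infinite F] {u : NormalMon →₀ F} (h : ∀ s t, evalMon s t u = 0) :
    u = 0 := by
  let P : (NormalMon →₀ F) →ₗ[F] MvPolynomial (ℕ ⊕ ℕ) F := Finsupp.linearCombination F
    fun q => MvPolynomial.monomial (Multiset.toFinsupp (monVars q)) 1
  have hP : Function.Injective P := by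
    have := (MvPolynomial.basisMonomials (ℕ ⊕ ℕ) F).linearIndependent.comp
      (fun q => Multiset.toFinsupp (monVars q))
      (Multiset.toFinsupp.injective.comp monVars_injective)
    rw [MvPolynomial.coe_basisMonomials] at this
    exact this
  apply hP
  rw [map_zero]
  refine MvPolynomial.funext fun v => ?_
  rw [map_zero, ← h (v ∘ Sum.inl) (v ∘ Sum.inr)]
  have : (MvPolynomial.aeval v).toLinearMap.comp P = evalMon (v ∘ Sum.inl) (v ∘ Sum.inr) := by
    refine Finsupp.lhom_ext' fun q => LinearMap.ext_ring ?_
    have : MvPolynomial.aeval v (P (Finsupp.single q 1)) = ((monVars q).map v).prod := by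
      simp only [P, Finsupp.linearCombination_single, one_smul]
      exact eval_monomial_toFinsupp v _
    refine this.trans ?_
    rcases q with ⟨j, m⟩ | M <;> simp [evalMon, monVars]
  exact LinearMap.congr_fun this u

/-- For `M₁`, β is the e₁₂-coefficient and α the e₂₂-coefficient of an evaluation. Under β the first
letter contributes c₀ t + c₁ s and every later letter c₀ s. Keeping α and β abstract lets the
reversed evaluation on `M₂` use the same statement. -/
theorem evalMon_normalForm {c₀ c₁ : I → F} {s t : ℕ → F} {α β : FreeDiff F I →ₗ[F] F}
    (hβ : ∀ f g, β (f * g) = β f * α g)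
    (hαg : ∀ j i, α (gen F (j, i)) = c₀ i * s j)
    (hβg : ∀ j i, β (gen F (j, i)) = c₀ i * t j + c₁ i * s j) (f : FreeDiff F I) :
    evalMon s t (normalForm c₀ c₁ f) = β f := by
  refine LinearMap.congr_fun (f := (evalMon s t).comp (normalForm c₀ c₁)) (g := β)
    (freeDiff_linearMap_ext fun ⟨p, l⟩ => ?_) f
  have hw : ∀ (l : List (ℕ × I)) f, β (l.foldl (fun f q => f * gen F q) f) =
      β f * ((l.map fun q => c₀ q.2).prod * ((l.map Prod.fst).map s).prod) := by
    intro l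
    induction l with
    | nil => simp
    | cons q l ih =>
      intro f
      rw [List.foldl_cons, ih, hβ, hαg]
      simp only [List.map_cons, List.prod_cons]
      ring
  rw [LinearMap.comp_apply, normalForm_single, single_eq_foldl, hw, hβg]
  simp only [normalWord, evalMon, map_smul, map_add, Finsupp.linearCombination_single,
    Sum.elim_inl, Sum.elim_inr, smul_eq_mul, Multiset.map_coe, Multiset.prod_coe, List.map_cons,
    List.prod_cons]
  ring

/-! ### The kernel of the normal form -/

variable {c₀ c₁ : I → F} {x y : ℕ → FreeDiff F I}

/-- Multiplication on the right by the variables of a list. -/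
def mulVars (x : ℕ → FreeDiff F I) : List ℕ → FreeDiff F I →ₗ[F] FreeDiff F I
  | [] => LinearMap.id
  | j :: l => (mulVars x l).comp (LinearMap.mulRight F (x j))

/-- The relations in J allow a map ψ from normal forms back to the quotient by J with ψ ∘
`normalForm` equal to the projection; anything killed by `normalForm` is then zero modulo J. Here x
j and y j play the roles of x_j and x_j^δ. -/
theorem ker_normalForm_le {J : Submodule F (FreeDiff F I)} (hleft : ∀ f g, g ∈ J → f * g ∈ J)
    (hright : ∀ f g, f ∈ J → f * g ∈ J) (hcomm : ∀ f i j, f * (x i * x j - x j * x i) ∈ J)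
    (hy : ∀ f j, f * y j ∈ J) (hxy : ∀ i j, y i * x j - y j * x i ∈ J)
    (hgen : ∀ j i, gen F (j, i) - (c₀ i • x j + c₁ i • y j) ∈ J) :
    LinearMap.ker (normalForm c₀ c₁) ≤ J := by
  have hmem : ∀ l, ∀ f ∈ J, mulVars x l f ∈ J := by
    intro l
    induction l with
    | nil => exact fun f hf => hf
    | cons j l ih => exact fun f hf => ih _ (hright _ _ hf)
  have hcongr : ∀ l f g, f - g ∈ J → J.mkQ (mulVars x l f) = J.mkQ (mulVars x l g) := by
    intro l f g h
    rw [← sub_eq_zero, ← map_sub, ← map_sub]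
    exact (Submodule.Quotient.mk_eq_zero J).2 (hmem l _ h)
  -- By `hcomm` the letters after the first factor commute modulo J, so only their multiset matters.
  have hperm : ∀ l l' : List ℕ, l.Perm l' → ∀ f,
      J.mkQ (mulVars x l f) = J.mkQ (mulVars x l' f) := by
    intro l l' h
    induction h with
    | nil => exact fun _ => rfl
    | cons a _ ih => exact fun f => ih _
    | swap a b l =>
      intro f
      refine hcongr l _ _ ?_
      have := hcomm f b a
      rwa [mul_sub, ← mul_assoc, ← mul_assoc] at this
    | trans _ _ ih ih' => exact fun f => (ih f).trans (ih' f)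
  -- The class of the monomial whose first letter carries δ. By `hxy` the δ may move to another
  -- letter, so all orders agree. The value 0 at the empty list is a default that no word reaches.
  let D : List ℕ → FreeDiff F I ⧸ J := fun l =>
    match l with
    | [] => 0
    | j :: l => J.mkQ (mulVars x l (y j))
  have hD : ∀ l l' : List ℕ, l.Perm l' → D l = D l' := by
    intro l l' h
    induction h with
    | nil => rfl
    | cons a h ih => exact hperm _ _ h _
    | swap a b l => exact hcongr l _ _ (hxy b a)
    | trans _ _ ih ih' => exact ih.trans ih'
  let ψ : (NormalMon →₀ F) →ₗ[F] FreeDiff F I ⧸ J := Finsupp.linearCombination F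
    (Sum.elim (fun q => J.mkQ (mulVars x q.2.toList (x q.1))) fun M => D M.toList)
  have hword : ∀ (l : List (ℕ × I)) f, J.mkQ (l.foldl (fun f q => f * gen F q) f) =
      (l.map fun q => c₀ q.2).prod • J.mkQ (mulVars x (l.map Prod.fst) f) := by
    intro l
    induction l with
    | nil => simp [mulVars]
    | cons q l ih =>
      intro f
      rw [List.foldl_cons, ih]
      -- Behind a factor f the δ-part of a letter dies by `hy`, leaving only its coefficient c₀.
      have h1 : f * gen F q - c₀ q.2 • (f * x q.1) ∈ J := by
        have := add_mem (hleft f _ (hgen q.1 q.2)) (J.smul_mem (c₁ q.2) (hy f q.1))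
        rw [mul_sub, mul_add, mul_smul_comm, mul_smul_comm] at this
        convert this using 1
        abel
      rw [hcongr _ _ _ h1, map_smul, map_smul, smul_smul, mul_comm, List.map_cons, List.prod_cons]
      rfl
  have hψ : ψ.comp (normalForm c₀ c₁) = J.mkQ := by
    refine freeDiff_linearMap_ext fun ⟨p, l⟩ => ?_
    rw [LinearMap.comp_apply, normalForm_single, single_eq_foldl, hword,
      hcongr _ _ _ (hgen p.1 p.2)]
    simp only [normalWord, ψ, map_smul, map_add, Finsupp.linearCombination_single, one_smul,
      Sum.elim_inl, Sum.elim_inr]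
    rw [hperm _ (l.map Prod.fst) (Multiset.coe_eq_coe.1 (Multiset.coe_toList _)),
      hD _ (p.1 :: l.map Prod.fst) (Multiset.coe_eq_coe.1 (Multiset.coe_toList _))]
  intro f hf
  rw [LinearMap.mem_ker] at hf
  rw [← Submodule.Quotient.mk_eq_zero, ← Submodule.mkQ_apply, ← hψ, LinearMap.comp_apply, hf,
    map_zero]

/-! ### Renaming the variables -/

/-- The action of a permutation of the variables on normal monomials. -/
def monRename (σ : Equiv.Perm ℕ) : NormalMon → NormalMon :=
  Sum.map (Prod.map σ (Multiset.map σ)) (Multiset.map σ)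

theorem normalForm_permVars (c₀ c₁ : I → F) (σ : Equiv.Perm ℕ) (f : FreeDiff F I) :
    normalForm c₀ c₁ (permVars F I σ f) =
      Finsupp.lmapDomain F F (monRename σ) (normalForm c₀ c₁ f) := by
  refine LinearMap.congr_fun (f := (normalForm c₀ c₁).comp (permVars F I σ))
    (g := (Finsupp.lmapDomain F F (monRename σ)).comp (normalForm c₀ c₁))
    (freeDiff_linearMap_ext fun w => ?_) f
  have h := map_toList (fun p : ℕ × I => (σ p.1, p.2)) w
  rw [List.map_cons, List.cons.injEq] at h
  rw [LinearMap.comp_apply, LinearMap.comp_apply, permVars_word, normalForm_single,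
    normalForm_single, h.1, h.2]
  simp only [normalWord, map_smul, map_add, Finsupp.lmapDomain_apply, Finsupp.mapDomain_single,
    monRename, Sum.map_inl, Sum.map_inr, Prod.map, Multiset.map_coe, List.map_cons, List.map_map,
    Function.comp_def]

/-! ### Reversal of words -/

/-- The antiautomorphism of the free algebra fixing the generators. -/
def reverse : FreeDiff F I →ₗ[F] FreeDiff F I :=
  (MulOpposite.opLinearEquiv F).symm.toLinearMap.comp
    ((subst fun p => MulOpposite.op (gen F p) : FreeDiff F I →ₙₐ[F] (FreeDiff F I)ᵐᵒᵖ) :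
      FreeDiff F I →ₗ[F] (FreeDiff F I)ᵐᵒᵖ)

theorem reverse_gen (p : ℕ × I) : reverse (gen F p) = gen F p := by
  simp [reverse]

theorem reverse_mul (f g : FreeDiff F I) : reverse (f * g) = reverse g * reverse f := by
  simp [reverse]

theorem reverse_reverse (f : FreeDiff F I) : reverse (reverse f) = f := by
  induction f using freeDiff_induction with
  | zero => simp
  | gen p => rw [reverse_gen, reverse_gen]
  | mul p f ih => rw [reverse_mul, reverse_mul, reverse_gen, reverse_gen, ih]
  | add f g hf hg => rw [map_add, map_add, hf, hg]
  | smul c f hf => rw [map_smul, map_smul, hf]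

theorem reverse_permVars (σ : Equiv.Perm ℕ) (f : FreeDiff F I) :
    reverse (permVars F I σ f) = permVars F I σ (reverse f) := by
  have hm (f g : FreeDiff F I) : permVars F I σ (f * g) = permVars F I σ f * permVars F I σ g :=
    map_mul (subst fun p : ℕ × I => gen F (σ p.1, p.2)) f g
  have hg (p : ℕ × I) : permVars F I σ (gen F p) = gen F (σ p.1, p.2) := subst_gen _ p
  induction f using freeDiff_induction with
  | zero => simp
  | gen p => rw [hg, reverse_gen, reverse_gen, hg]
  | mul p f ih => rw [reverse_mul, hm, hm, reverse_mul, ih, hg, reverse_gen, reverse_gen, hg]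
  | add f g hf hg => simp only [map_add, hf, hg]
  | smul c f hf => simp only [map_smul, hf]

theorem reverse_word (w : FreeSemigroup (ℕ × I)) : ∃ w' : FreeSemigroup (ℕ × I),
    reverse (MonoidAlgebra.single w 1 : FreeDiff F I) = MonoidAlgebra.single w' 1 ∧
      w'.head :: w'.tail = (w.head :: w.tail).reverse := by
  induction w with
  | ih1 p => exact ⟨FreeSemigroup.of p, reverse_gen p, rfl⟩
  | ih2 p w _ ih =>
    obtain ⟨w', h, hw'⟩ := ih
    refine ⟨w' * FreeSemigroup.of p, ?_, ?_⟩
    · have : (MonoidAlgebra.single (FreeSemigroup.of p * w) 1 : FreeDiff F I) =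
          gen F p * MonoidAlgebra.single w 1 := by
        rw [gen, MonoidAlgebra.single_mul_single, mul_one]
      rw [this, reverse_mul, h, reverse_gen, gen, MonoidAlgebra.single_mul_single, mul_one]
    · rw [FreeSemigroup.head_mul, FreeSemigroup.tail_mul, FreeSemigroup.head_mul,
        FreeSemigroup.tail_mul]
      change (w'.head :: w'.tail) ++ [p] = (p :: w.head :: w.tail).reverse
      rw [hw', List.reverse_cons (a := p)]

theorem reverse_xpow {L : Type w} [LieRing L] [LieAlgebra F L]
    (b : Module.Basis I F (UniversalEnvelopingAlgebra F L)) (j : ℕ) (h) :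
    reverse (xpow b j h) = xpow b j h := by
  refine LinearMap.congr_fun (f := reverse.comp (xpow b j)) (b.ext fun i => ?_) h
  rw [LinearMap.comp_apply, xpow_basis, reverse_gen]

end NormalForm

/-! ### The identities of M₁ and M₂ -/

section IdealsOfIdentities

variable {F : Type u} [Field F]
variable {L : Type w} [LieRing L] [LieAlgebra F L]
variable {I : Type z}
variable (b : Module.Basis I F (UniversalEnvelopingAlgebra F L))

theorem exists_M₁ (s t : F) : ∃ a : M₁ F, (a : Matrix (Fin 2) (Fin 2) F) 1 1 = s ∧
    (a : Matrix (Fin 2) (Fin 2) F) 0 1 = t :=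
  ⟨⟨_, s, t, rfl⟩, by simp, by simp⟩

theorem exists_M₂ (s t : F) : ∃ a : M₂ F, (a : Matrix (Fin 2) (Fin 2) F) 0 0 = s ∧
    (a : Matrix (Fin 2) (Fin 2) F) 0 1 = t :=
  ⟨⟨_, s, t, rfl⟩, by simp, by simp⟩

/-- An entry of `2 × 2` matrices as a functional on `M₁`. -/
def entry₁ (i j : Fin 2) : M₁ F →ₗ[F] F where
  toFun a := (a : Matrix (Fin 2) (Fin 2) F) i j
  map_add' _ _ := rfl
  map_smul' _ _ := rfl

/-- An entry of `2 × 2` matrices as a functional on `M₂`. -/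
def entry₂ (i j : Fin 2) : M₂ F →ₗ[F] F where
  toFun a := (a : Matrix (Fin 2) (Fin 2) F) i j
  map_add' _ _ := rfl
  map_smul' _ _ := rfl

theorem entry₁_apply (i j : Fin 2) (a : M₁ F) :
    entry₁ i j a = (a : Matrix (Fin 2) (Fin 2) F) i j := rfl

/-- The first column of every element of `M₁` is zero, so only one term of the matrix product
survives. -/
theorem entry₁_mul (i : Fin 2) (a a' : M₁ F) :
    entry₁ i 1 (a * a') = entry₁ i 1 a * entry₁ 1 1 a' := by
  obtain ⟨_, α, β, rfl⟩ := a
  obtain ⟨_, α', β', rfl⟩ := a'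
  fin_cases i <;> simp [entry₁_apply, Matrix.mul_apply]

theorem entry₂_apply (i j : Fin 2) (a : M₂ F) :
    entry₂ i j a = (a : Matrix (Fin 2) (Fin 2) F) i j := rfl

/-- The second row of every element of `M₂` is zero. The distinguished factor is now the last one,
the mirror image of `entry₁_mul`. -/
theorem entry₂_mul (i : Fin 2) (a a' : M₂ F) :
    entry₂ 0 i (a * a') = entry₂ 0 0 a * entry₂ 0 i a' := by
  obtain ⟨_, α, β, rfl⟩ := a
  obtain ⟨_, α', β', rfl⟩ := a'
  fin_cases i <;> simp [entry₂_apply, Matrix.mul_apply]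

theorem M₁_ext {a a' : M₁ F} (h : entry₁ 1 1 a = entry₁ 1 1 a')
    (h' : entry₁ 0 1 a = entry₁ 0 1 a') : a = a' := by
  obtain ⟨_, α, β, rfl⟩ := a
  obtain ⟨_, α', β', rfl⟩ := a'
  simp only [entry₁_apply] at h h'
  simp at h h'
  simp [h, h']

theorem M₂_ext {a a' : M₂ F} (h : entry₂ 0 0 a = entry₂ 0 0 a')
    (h' : entry₂ 0 1 a = entry₂ 0 1 a') : a = a' := by
  obtain ⟨_, α, β, rfl⟩ := a
  obtain ⟨_, α', β', rfl⟩ := a'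
  simp only [entry₂_apply] at h h'
  simp at h h'
  simp [h, h']

theorem entry₁_δ₁ (a : M₁ F) :
    entry₁ 1 1 ((δ₁ F : Module.End F (M₁ F)) a) = 0 ∧
      entry₁ 0 1 ((δ₁ F : Module.End F (M₁ F)) a) = entry₁ 1 1 a := by
  simp [entry₁_apply, δ₁]

theorem entry₂_δ₂ (a : M₂ F) :
    entry₂ 0 0 ((δ₂ F : Module.End F (M₂ F)) a) = 0 ∧
      entry₂ 0 1 ((δ₂ F : Module.End F (M₂ F)) a) = entry₂ 0 0 a := by
  simp [entry₂_apply, δ₂]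

variable {b}

theorem gens₁_subset_IdL (d : L) (ρ : L →ₗ⁅F⁆ Der F (M₁ F)) (hd : ρ d = δ₁ F) :
    gens₁ b d ⊆ IdL b ρ := by
  rintro f (rfl | rfl | rfl | rfl) a <;> apply M₁_ext <;>
    simp [-UniversalEnvelopingAlgebra.ι_apply, pow_two, evalAt_xpow, uAct_ι, hd, entry₁_mul, entry₁_δ₁, mul_comm]

theorem gens₂_subset_IdL (d : L) (ρ : L →ₗ⁅F⁆ Der F (M₂ F)) (hd : ρ d = δ₂ F) :
    gens₂ b d ⊆ IdL b ρ := by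
  rintro f (rfl | rfl | rfl | rfl) a <;> apply M₂_ext <;>
    simp [-UniversalEnvelopingAlgebra.ι_apply, pow_two, evalAt_xpow, uAct_ι, hd, entry₂_mul, entry₂_δ₂, mul_comm]

theorem trivGens_subset_IdL {A : Type v} [NonUnitalRing A] [Module F A] [IsScalarTower F A A]
    [SMulCommClass F A A] (ρ : L →ₗ⁅F⁆ Der F A) : trivGens b ρ ⊆ IdL b ρ := by
  rintro f ⟨γ, hγ, rfl⟩ a
  rw [evalAt_xpow, uAct_ι, hγ]
  rfl

/-- The differential identities of `M₁`, by generators and by normal forms. -/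
theorem IdL_M₁ [Infinite F] (d : L) (ρ : L →ₗ⁅F⁆ Der F (M₁ F)) (hd : ρ d = δ₁ F)
    (hρ : ∀ γ : L, ∃ c : F, ρ γ = c • δ₁ F) : ∃ c₀ c₁ : I → F,
      (∀ a f, evalMon (fun j => entry₁ 1 1 (a j)) (fun j => entry₁ 0 1 (a j))
        (normalForm c₀ c₁ f) = entry₁ 0 1 (evalAt b ρ a f)) ∧
      IdL b ρ = TLSpan b (gens₁ b d ∪ trivGens b ρ) ∧
      IdL b ρ = LinearMap.ker (normalForm c₀ c₁) := by
  set S := gens₁ b d ∪ trivGens b ρ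
  have hJ := isTLIdeal_TLSpan b S
  have hS := subset_TLSpan b S
  have hle : TLSpan b S ≤ IdL b ρ := TLSpan_le b (isTLIdeal_IdL b ρ)
    (Set.union_subset (gens₁_subset_IdL d ρ hd) (trivGens_subset_IdL ρ))
  obtain ⟨c₀, c₁, hc, hgen⟩ := exists_coeff b ρ hJ d (by rwa [hd])
    (fun f hf => hS (Or.inr hf)) (hS (Or.inl (by simp [gens₁]))) hle
  have heval : ∀ a f, evalMon (fun j => entry₁ 1 1 (a j)) (fun j => entry₁ 0 1 (a j))
      (normalForm c₀ c₁ f) = entry₁ 0 1 (evalAt b ρ a f) := by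
    intro a f
    refine evalMon_normalForm
      (α := (entry₁ 1 1).comp (evalAt b ρ a : FreeDiff F I →ₗ[F] M₁ F))
      (β := (entry₁ 0 1).comp (evalAt b ρ a : FreeDiff F I →ₗ[F] M₁ F)) ?_ ?_ ?_ f
    · intro f g
      simp [entry₁_mul]
    · intro j i
      simp [evalAt, hc, hd, entry₁_δ₁]
    · intro j i
      simp [evalAt, hc, hd, entry₁_δ₁]
  -- The e₁₂-coefficient alone already detects the normal form, since the pairs (s j, t j) can be
  -- prescribed freely.
  have hker : IdL b ρ ≤ LinearMap.ker (normalForm c₀ c₁) := by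
    intro f hf
    refine evalMon_separates fun s t => ?_
    choose a ha using fun j => exists_M₁ (s j) (t j)
    have := heval a f
    rw [hf a, map_zero] at this
    convert this using 2
    exact congrArg₂ _ (funext fun j => (ha j).1.symm) (funext fun j => (ha j).2.symm)
  have hker' : LinearMap.ker (normalForm c₀ c₁) ≤ TLSpan b S := by
    refine ker_normalForm_le (x := fun j => xpow b j 1)
      (y := fun j => xpow b j (UniversalEnvelopingAlgebra.ι F d)) hJ.mul_mem_left hJ.mul_mem_right
      (fun f i j => ?_) (fun f j => ?_) (fun i j => ?_) hgen
    -- Each relation needed is a generator with an arbitrary polynomial f or variables substituted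
    -- for its letters.
    · have h : xpow b 0 1 * (xpow b 1 1 * xpow b 2 1 - xpow b 2 1 * xpow b 1 1) ∈ TLSpan b S :=
        hS (Or.inl (by simp [gens₁]))
      simpa [evalAt_xpow] using hJ.evalAt_mem
        (fun k => match k with | 0 => f | 1 => xpow b i 1 | _ => xpow b j 1) h
    · have h : xpow b 0 1 * xpow b 1 (UniversalEnvelopingAlgebra.ι F d) ∈ TLSpan b S :=
        hS (Or.inl (by simp [gens₁]))
      simpa [evalAt_xpow, uAct_xpow] using hJ.evalAt_mem
        (fun k => match k with | 0 => f | _ => xpow b j 1) h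
    · have h : xpow b 0 (UniversalEnvelopingAlgebra.ι F d) * xpow b 1 1 -
          xpow b 1 (UniversalEnvelopingAlgebra.ι F d) * xpow b 0 1 ∈ TLSpan b S :=
        hS (Or.inl (by simp [gens₁]))
      simpa [evalAt_xpow, uAct_xpow] using hJ.evalAt_mem
        (fun k => match k with | 0 => xpow b i 1 | _ => xpow b j 1) h
  exact ⟨c₀, c₁, heval, le_antisymm (hker.trans hker') hle,
    le_antisymm hker (hker'.trans hle)⟩

/-- The differential identities of `M₂`, by generators and by normal forms of reversed words. -/
theorem IdL_M₂ [Infinite F] (d : L) (ρ : L →ₗ⁅F⁆ Der F (M₂ F)) (hd : ρ d = δ₂ F)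
    (hρ : ∀ γ : L, ∃ c : F, ρ γ = c • δ₂ F) : ∃ c₀ c₁ : I → F,
      (∀ a f, evalMon (fun j => entry₂ 0 0 (a j)) (fun j => entry₂ 0 1 (a j))
        (normalForm c₀ c₁ f) = entry₂ 0 1 (evalAt b ρ a (reverse f))) ∧
      IdL b ρ = TLSpan b (gens₂ b d ∪ trivGens b ρ) ∧
      IdL b ρ = LinearMap.ker ((normalForm c₀ c₁).comp reverse) := by
  set S := gens₂ b d ∪ trivGens b ρ
  have hJ := isTLIdeal_TLSpan b S
  have hS := subset_TLSpan b S
  have hle : TLSpan b S ≤ IdL b ρ := TLSpan_le b (isTLIdeal_IdL b ρ)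
    (Set.union_subset (gens₂_subset_IdL d ρ hd) (trivGens_subset_IdL ρ))
  obtain ⟨c₀, c₁, hc, hgen⟩ := exists_coeff b ρ hJ d (by rwa [hd])
    (fun f hf => hS (Or.inr hf)) (hS (Or.inl (by simp [gens₂]))) hle
  have heval : ∀ a f, evalMon (fun j => entry₂ 0 0 (a j)) (fun j => entry₂ 0 1 (a j))
      (normalForm c₀ c₁ f) = entry₂ 0 1 (evalAt b ρ a (reverse f)) := by
    intro a f
    refine evalMon_normalForm
      -- Composing with `reverse` makes the first letter the distinguished one again, as
      -- `evalMon_normalForm` requires.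
      (α := ((entry₂ 0 0).comp (evalAt b ρ a : FreeDiff F I →ₗ[F] M₂ F)).comp reverse)
      (β := ((entry₂ 0 1).comp (evalAt b ρ a : FreeDiff F I →ₗ[F] M₂ F)).comp reverse) ?_ ?_ ?_ f
    · intro f g
      simp [reverse_mul, entry₂_mul, mul_comm]
    · intro j i
      simp [reverse_gen, evalAt, hc, hd, entry₂_δ₂]
    · intro j i
      simp [reverse_gen, evalAt, hc, hd, entry₂_δ₂]
  have hker : IdL b ρ ≤ LinearMap.ker ((normalForm c₀ c₁).comp reverse) := by
    intro f hf
    refine evalMon_separates fun s t => ?_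
    choose a ha using fun j => exists_M₂ (s j) (t j)
    have := heval a (reverse f)
    rw [reverse_reverse, hf a, map_zero] at this
    rw [LinearMap.comp_apply]
    convert this using 2
    exact congrArg₂ _ (funext fun j => (ha j).1.symm) (funext fun j => (ha j).2.symm)
  have hker' : LinearMap.ker (normalForm c₀ c₁) ≤ (TLSpan b S).comap reverse := by
    refine ker_normalForm_le (x := fun j => xpow b j 1)
      (y := fun j => xpow b j (UniversalEnvelopingAlgebra.ι F d))
      (fun f g hg => ?_) (fun f g hf => ?_)
      -- Pulling back along `reverse` interchanges left and right multiplication and swaps the order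
      -- of i and j in the relations, hence the swapped substitutions below.
      (fun f i j => ?_) (fun f j => ?_) (fun i j => ?_) (fun j i => ?_) <;>
      simp only [Submodule.mem_comap, map_sub, map_add, map_smul, reverse_mul, reverse_xpow,
        reverse_gen]
    · exact hJ.mul_mem_right _ _ hg
    · exact hJ.mul_mem_left _ _ hf
    · have h : (xpow b 0 1 * xpow b 1 1 - xpow b 1 1 * xpow b 0 1) * xpow b 2 1 ∈ TLSpan b S :=
        hS (Or.inl (by simp [gens₂]))
      simpa [evalAt_xpow] using hJ.evalAt_mem
        (fun k => match k with | 0 => xpow b j 1 | 1 => xpow b i 1 | _ => reverse f) h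
    · have h : xpow b 0 (UniversalEnvelopingAlgebra.ι F d) * xpow b 1 1 ∈ TLSpan b S :=
        hS (Or.inl (by simp [gens₂]))
      simpa [evalAt_xpow, uAct_xpow] using hJ.evalAt_mem
        (fun k => match k with | 0 => xpow b j 1 | _ => reverse f) h
    · have h : xpow b 0 1 * xpow b 1 (UniversalEnvelopingAlgebra.ι F d) -
          xpow b 1 1 * xpow b 0 (UniversalEnvelopingAlgebra.ι F d) ∈ TLSpan b S :=
        hS (Or.inl (by simp [gens₂]))
      simpa [evalAt_xpow, uAct_xpow] using hJ.evalAt_mem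
        (fun k => match k with | 0 => xpow b j 1 | _ => xpow b i 1) h
    · exact hgen j i
  have hker'' : LinearMap.ker ((normalForm c₀ c₁).comp reverse) ≤ TLSpan b S := by
    intro f hf
    have : reverse f ∈ (TLSpan b S).comap reverse := hker' hf
    rwa [Submodule.mem_comap, reverse_reverse] at this
  exact ⟨c₀, c₁, heval, le_antisymm (hker.trans hker'') hle,
    le_antisymm hker (hker''.trans hle)⟩

/-- For a faithful action the generators `x^γ`, with `γ` acting trivially, are redundant. -/
theorem TLSpan_union_trivGens_of_injective {A : Type v} [NonUnitalRing A] [Module F A]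
    [IsScalarTower F A A] [SMulCommClass F A A] {ρ : L →ₗ⁅F⁆ Der F A}
    (hρ : Function.Injective ρ) (S : Set (FreeDiff F I)) :
    TLSpan b (S ∪ trivGens b ρ) = TLSpan b S := by
  refine le_antisymm (TLSpan_le b (isTLIdeal_TLSpan b S) (Set.union_subset (subset_TLSpan b S) ?_))
    (TLSpan_le b (isTLIdeal_TLSpan b _) (Set.subset_union_left.trans (subset_TLSpan b _)))
  rintro f ⟨γ, hγ, rfl⟩
  have : γ = 0 := hρ (hγ.trans (map_zero ρ).symm)
  subst this
  rw [map_zero, map_zero]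
  exact zero_mem _

end IdealsOfIdentities

/-! ### Multilinear polynomials and multilinear normal monomials -/

section Multilinear

variable {F : Type u} [Field F] {I : Type z}

/-- The span of the words whose sequence of variables is `l`. -/
def wordSpan (F : Type u) [Field F] (I : Type z) (l : List ℕ) : Submodule F (FreeDiff F I) :=
  Submodule.span F {f | ∃ w : FreeSemigroup (ℕ × I),
    (w.head :: w.tail).map Prod.fst = l ∧ f = MonoidAlgebra.single w 1}

theorem mul_mem_wordSpan {l l' : List ℕ} {f g : FreeDiff F I} (hf : f ∈ wordSpan F I l)
    (hg : g ∈ wordSpan F I l') : f * g ∈ wordSpan F I (l ++ l') := by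
  induction hf using Submodule.span_induction with
  | zero => rw [zero_mul]; exact zero_mem _
  | add f f' _ _ h h' => rw [add_mul]; exact add_mem h h'
  | smul c f _ h => rw [smul_mul_assoc]; exact Submodule.smul_mem _ c h
  | mem f hf =>
    obtain ⟨w, rfl, rfl⟩ := hf
    induction hg using Submodule.span_induction with
    | zero => rw [mul_zero]; exact zero_mem _
    | add f f' _ _ h h' => rw [mul_add]; exact add_mem h h'
    | smul c f _ h => rw [mul_smul_comm]; exact Submodule.smul_mem _ c h
    | mem g hg =>
      obtain ⟨w', rfl, rfl⟩ := hg
      rw [MonoidAlgebra.single_mul_single, mul_one]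
      refine Submodule.subset_span ⟨_, ?_, rfl⟩
      simp

theorem xpow_mem_wordSpan {L : Type w} [LieRing L] [LieAlgebra F L]
    (b : Module.Basis I F (UniversalEnvelopingAlgebra F L)) (j : ℕ) (h) :
    xpow b j h ∈ wordSpan F I [j] := by
  have : LinearMap.range (xpow b j) ≤ wordSpan F I [j] := by
    rw [xpow, Module.Basis.constr_range, Submodule.span_le]
    rintro _ ⟨i, rfl⟩
    exact Submodule.subset_span ⟨FreeSemigroup.of (j, i), rfl, rfl⟩
  exact this ⟨h, rfl⟩

theorem mulVars_mem_wordSpan {x : ℕ → FreeDiff F I} (hx : ∀ j, x j ∈ wordSpan F I [j])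
    (l : List ℕ) : ∀ {l' : List ℕ} {f : FreeDiff F I}, f ∈ wordSpan F I l' →
      mulVars x l f ∈ wordSpan F I (l' ++ l) := by
  induction l with
  | nil => intro l' f hf; simpa [mulVars] using hf
  | cons j l ih =>
    intro l' f hf
    have := ih (mul_mem_wordSpan hf (hx j))
    rwa [List.append_assoc] at this

theorem map_fst_perm_range {n : ℕ} {l : List (ℕ × I)} {σ : Equiv.Perm (Fin n)} {h : Fin n → I}
    (hl : l = List.ofFn fun k => ((σ k : ℕ), h k)) : (l.map Prod.fst).Perm (List.range n) := by
  rw [hl, List.map_ofFn, List.perm_ext_iff_of_nodup _ List.nodup_range]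
  · intro a
    rw [List.mem_ofFn, List.mem_range]
    exact ⟨fun ⟨k, hk⟩ => hk ▸ (σ k).2, fun ha => ⟨σ.symm ⟨a, ha⟩, by simp⟩⟩
  · rw [List.nodup_ofFn]
    exact Fin.val_injective.comp σ.injective

theorem exists_eq_ofFn {n : ℕ} {l : List (ℕ × I)} (hl : (l.map Prod.fst).Perm (List.range n)) :
    ∃ (σ : Equiv.Perm (Fin n)) (h : Fin n → I), l = List.ofFn fun k => ((σ k : ℕ), h k) := by
  obtain rfl : l.length = n := by simpa using hl.length_eq
  have hnd : (l.map Prod.fst).Nodup := hl.nodup_iff.2 List.nodup_range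
  have hlt : ∀ k : Fin l.length, l[k].1 < l.length := fun k =>
    List.mem_range.1 (hl.subset (List.mem_map_of_mem (List.getElem_mem k.2)))
  have hinj : Function.Injective fun k : Fin l.length => (⟨l[k].1, hlt k⟩ : Fin l.length) := by
    intro k k' hk
    have h1 : (l.map Prod.fst)[(k : ℕ)]'(by simp) = (l.map Prod.fst)[(k' : ℕ)]'(by simp) := by
      simpa using hk
    exact Fin.ext ((hnd.getElem_inj_iff).1 h1)
  refine ⟨Equiv.ofBijective _ (Finite.injective_iff_bijective.1 hinj), fun k => l[k].2, ?_⟩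
  exact List.ofFn_getElem.symm

/-- Describing the words through `List.Perm` of their variables makes concatenation and reversal
accessible without handling permutations of `Fin n`. -/
theorem multilin_eq_span (n : ℕ) : multilin F I n = Submodule.span F
    {f | ∃ w : FreeSemigroup (ℕ × I), ((w.head :: w.tail).map Prod.fst).Perm (List.range n) ∧
      f = MonoidAlgebra.single w 1} := by
  rw [multilin]
  congr 1
  ext f
  constructor
  · rintro ⟨w, σ, h, hw, rfl⟩
    exact ⟨w, map_fst_perm_range hw, rfl⟩
  · rintro ⟨w, hw, rfl⟩
    obtain ⟨σ, h, hσ⟩ := exists_eq_ofFn hw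
    exact ⟨w, σ, h, hσ, rfl⟩

theorem wordSpan_le_multilin {n : ℕ} {l : List ℕ} (hl : l.Perm (List.range n)) :
    wordSpan F I l ≤ multilin F I n := by
  rw [multilin_eq_span, wordSpan]
  refine Submodule.span_mono ?_
  rintro f ⟨w, rfl, rfl⟩
  exact ⟨w, hl, rfl⟩

theorem reverse_mem_multilin {n : ℕ} {f : FreeDiff F I} (hf : f ∈ multilin F I n) :
    reverse f ∈ multilin F I n := by
  suffices h : multilin F I n ≤ (multilin F I n).comap reverse from h hf
  rw [multilin_eq_span, Submodule.span_le]
  rintro _ ⟨w, hw, rfl⟩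
  obtain ⟨w', h, hw'⟩ := reverse_word (F := F) w
  refine Submodule.subset_span ⟨w', ?_, h⟩
  rw [hw', List.map_reverse]
  exact (List.reverse_perm _).trans hw

/-- The multilinear normal monomials in the first `n` variables: `x_j` followed by the other
variables, and the one containing `δ`. -/
def multilinMon (n : ℕ) : Option (Fin n) → NormalMon
  | none => Sum.inr ↑(List.range n)
  | some j => Sum.inl (j, ↑((List.range n).erase j))

theorem multilinMon_injective (n : ℕ) : Function.Injective (multilinMon n) := by
  rintro (_ | j) (_ | j') h
  · rfl
  · exact absurd h Sum.inr_ne_inl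
  · exact absurd h Sum.inl_ne_inr
  · exact congrArg some (Fin.ext (Prod.ext_iff.1 (Sum.inl.inj h)).1)

/-- In a multilinear word the first variable determines the multiset of the others, so only n + 1
normal monomials can occur. -/
theorem normalForm_mem_span (c₀ c₁ : I → F) {n : ℕ} {f : FreeDiff F I}
    (hf : f ∈ multilin F I n) : normalForm c₀ c₁ f ∈
      Submodule.span F (Set.range fun o => Finsupp.single (multilinMon n o) (1 : F)) := by
  suffices h : multilin F I n ≤ (Submodule.span F (Set.range fun o =>
    Finsupp.single (multilinMon n o) (1 : F))).comap (normalForm c₀ c₁) from h hf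
  rw [multilin_eq_span, Submodule.span_le]
  rintro _ ⟨w, hw, rfl⟩
  rw [SetLike.mem_coe, Submodule.mem_comap, normalForm_single, normalWord]
  rw [List.map_cons] at hw
  have hlt : w.head.1 < n := List.mem_range.1 (hw.subset List.mem_cons_self)
  refine Submodule.smul_mem _ _ (add_mem (Submodule.smul_mem _ _ (Submodule.subset_span
    ⟨some ⟨w.head.1, hlt⟩, ?_⟩)) (Submodule.smul_mem _ _ (Submodule.subset_span ⟨none, ?_⟩)))
  · have : ((w.tail.map Prod.fst : List ℕ) : Multiset ℕ) = ((List.range n).erase w.head.1) :=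
      Multiset.coe_eq_coe.2 (List.cons_perm_iff_perm_erase.1 hw).2
    rw [this]
    rfl
  · rw [Multiset.coe_eq_coe.2 hw]
    rfl

theorem monRename_multilinMon {n : ℕ} (σ : Equiv.Perm (Fin n)) (o : Option (Fin n)) :
    monRename (σ.viaEmbedding Fin.valEmbedding) (multilinMon n o) =
      multilinMon n (o.map σ) := by
  have hσ : ∀ k : Fin n, σ.viaEmbedding Fin.valEmbedding k = σ k := by
    intro k
    simpa using Equiv.Perm.viaEmbedding_apply σ Fin.valEmbedding k
  have hr : (Multiset.range n).map (σ.viaEmbedding Fin.valEmbedding) = Multiset.range n := by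
    refine (Multiset.Nodup.ext ((Multiset.nodup_range n).map (Equiv.injective _))
      (Multiset.nodup_range n)).2 fun a => ?_
    simp only [Multiset.mem_map, Multiset.mem_range]
    constructor
    · rintro ⟨k, hk, rfl⟩
      rw [hσ ⟨k, hk⟩]
      exact (σ _).2
    · intro ha
      exact ⟨σ.symm ⟨a, ha⟩, Fin.is_lt _, by rw [hσ]; simp⟩
  rcases o with _ | j
  · exact congrArg Sum.inr hr
  · refine congrArg Sum.inl (Prod.ext (hσ j) ?_)
    change ((Multiset.range n).erase j).map _ = (Multiset.range n).erase _
    rw [Multiset.map_erase _ (Equiv.injective _), hr, hσ]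

theorem map_mulVars {x : ℕ → FreeDiff F I} {s : ℕ → F} {α β : FreeDiff F I →ₗ[F] F}
    (hβ : ∀ f g, β (f * g) = β f * α g) (hα : ∀ j, α (x j) = s j) (l : List ℕ) :
    ∀ f, β (mulVars x l f) = β f * (l.map s).prod := by
  induction l with
  | nil => simp [mulVars]
  | cons j l ih =>
    intro f
    rw [mulVars, LinearMap.comp_apply, ih, LinearMap.mulRight_apply, hβ, hα, List.map_cons,
      List.prod_cons, mul_assoc]

/-- The preimages are x_j, or x_0^δ (here y), times the remaining variables. Their normal forms are
identified through evaluations, which separate normal forms, so no word has to be expanded in the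
basis of U(L). -/
theorem exists_multilin {Θ : FreeDiff F I →ₗ[F] NormalMon →₀ F} [Infinite F] {n : ℕ}
    (hn : 1 ≤ n) (x : ℕ → FreeDiff F I) (y : FreeDiff F I)
    (hx : ∀ j, x j ∈ wordSpan F I [j]) (hy : y ∈ wordSpan F I [0])
    (heval : ∀ s t : ℕ → F, ∃ α β : FreeDiff F I →ₗ[F] F, (∀ f, evalMon s t (Θ f) = β f) ∧
      (∀ f g, β (f * g) = β f * α g) ∧ (∀ j, α (x j) = s j) ∧ (∀ j, β (x j) = t j) ∧ β y = s 0)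
    (o : Option (Fin n)) :
    ∃ f ∈ multilin F I n, Θ f = Finsupp.single (multilinMon n o) 1 := by
  have hmem : ∀ {j} {f : FreeDiff F I}, j < n → f ∈ wordSpan F I [j] →
      mulVars x ((List.range n).erase j) f ∈ multilin F I n := fun hj hf =>
    wordSpan_le_multilin (l := [_] ++ _) (List.perm_cons_erase (List.mem_range.2 hj)).symm
      (mulVars_mem_wordSpan hx _ hf)
  rcases o with _ | j
  -- The letter carrying δ is taken to be x_0, which is among the variables because n ≥ 1.
  · refine ⟨_, hmem hn hy, sub_eq_zero.1 (evalMon_separates fun s t => ?_)⟩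
    obtain ⟨α, β, hΘ, hβ, hα, -, hy'⟩ := heval s t
    have h := (((List.perm_cons_erase (List.mem_range.2 hn)).map s).prod_eq)
    rw [List.map_cons, List.prod_cons] at h
    rw [map_sub, hΘ, map_mulVars hβ hα, hy', ← h]
    simp only [evalMon, multilinMon, Finsupp.linearCombination_single, one_smul, Sum.elim_inr,
      Multiset.map_coe, Multiset.prod_coe, sub_self]
  · refine ⟨_, hmem j.2 (hx j), sub_eq_zero.1 (evalMon_separates fun s t => ?_)⟩
    obtain ⟨α, β, hΘ, hβ, hα, hx', -⟩ := heval s t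
    rw [map_sub, hΘ, map_mulVars hβ hα, hx']
    simp only [evalMon, multilinMon, Finsupp.linearCombination_single, one_smul, Sum.elim_inl,
      Multiset.map_coe, Multiset.prod_coe, sub_self]

end Multilinear

/-! ### Codimensions and cocharacters from the normal basis -/

section Cocharacters

variable {F : Type u} [Field F] {L : Type w} [LieRing L] [LieAlgebra F L] {I : Type z}
variable {b : Module.Basis I F (UniversalEnvelopingAlgebra F L)}
variable {A : Type v} [NonUnitalRing A] [Module F A] [IsScalarTower F A A] [SMulCommClass F A A]
variable {ρ : L →ₗ⁅F⁆ Der F A}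

theorem trace_of_permutes_basis {V ι : Type*} [AddCommGroup V] [Module F V] [Fintype ι]
    [DecidableEq ι] (B : Module.Basis ι F V) (f : Module.End F V) (s : ι → ι)
    (hf : ∀ i, f (B i) = B (s i)) :
    LinearMap.trace F V f = ∑ i, if s i = i then (1 : F) else 0 := by
  rw [LinearMap.trace_eq_matrix_trace F B, Matrix.trace]
  refine Finset.sum_congr rfl fun i _ => ?_
  rw [Matrix.diag_apply, LinearMap.toMatrix_apply, hf, Module.Basis.repr_self,
    Finsupp.single_apply]

/-- If the identities are the kernel of an equivariant map `Θ` to the normal forms which maps the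
multilinear polynomials onto the multilinear normal forms, then the multilinear normal monomials
give a basis of the relatively free module, permuted by `S_n`. -/
theorem codim_cochar_of_normalForm {Θ : FreeDiff F I →ₗ[F] NormalMon →₀ F}
    (hker : IdL b ρ = LinearMap.ker Θ)
    (hperm : ∀ σ f, Θ (permVars F I σ f) = Finsupp.lmapDomain F F (monRename σ) (Θ f)) {n : ℕ}
    (hle : ∀ f ∈ multilin F I n, Θ f ∈
      Submodule.span F (Set.range fun o => Finsupp.single (multilinMon n o) (1 : F)))
    (hex : ∀ o, ∃ f ∈ multilin F I n, Θ f = Finsupp.single (multilinMon n o) 1) :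
    codim b ρ n = n + 1 ∧
      ∀ σ, cochar b ρ n σ = 1 + ∑ k, if σ k = k then (1 : F) else 0 := by
  let Φ : (multilin F I n ⧸ multilinId b ρ n) →ₗ[F] NormalMon →₀ F :=
    (multilinId b ρ n).liftQ (Θ.comp (multilin F I n).subtype) fun f hf => by
      have : (f : FreeDiff F I) ∈ IdL b ρ := hf
      rwa [hker] at this
  have hΦ : ∀ f : multilin F I n, Φ ((multilinId b ρ n).mkQ f) = Θ f := fun f => rfl
  have hinj : Function.Injective Φ := by
    refine LinearMap.ker_eq_bot.1 (Submodule.ker_liftQ_eq_bot _ _ _ fun f hf => ?_)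
    change (f : FreeDiff F I) ∈ IdL b ρ
    rwa [hker]
  choose g hg hΘg using hex
  let B₀ : Option (Fin n) → multilin F I n ⧸ multilinId b ρ n := fun o =>
    (multilinId b ρ n).mkQ ⟨g o, hg o⟩
  have hB₀ : ∀ o, Φ (B₀ o) = Finsupp.single (multilinMon n o) 1 := hΘg
  have hli : LinearIndependent F B₀ := by
    refine LinearIndependent.of_comp Φ ?_
    have : Φ ∘ B₀ = (fun m => Finsupp.single m (1 : F)) ∘ multilinMon n := funext hB₀
    rw [this]
    exact (Finsupp.linearIndependent_single_one F NormalMon).comp _ (multilinMon_injective n)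
  -- Spanning is pulled back through the injective Φ: the image of each class lies in the span of
  -- the images of the B₀ o.
  have hsp : ⊤ ≤ Submodule.span F (Set.range B₀) := by
    rintro q -
    obtain ⟨f, rfl⟩ := (multilinId b ρ n).mkQ_surjective q
    have h := hle f f.2
    rw [← hΦ, ← funext hB₀, Set.range_comp' Φ B₀, Submodule.span_image] at h
    obtain ⟨q, hq, hq'⟩ := h
    rwa [← hinj hq']
  let B := Module.Basis.mk hli hsp
  have hB : ∀ o, B o = B₀ o := fun o => Module.Basis.mk_apply hli hsp o
  refine ⟨?_, fun σ => ?_⟩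
  · rw [codim, Module.finrank_eq_card_basis B, Fintype.card_option, Fintype.card_fin]
  · have hact : ∀ o, relFreeRep b ρ n σ (B o) = B (o.map σ) := by
      intro o
      apply hinj
      rw [hB, hB, hB₀, ← monRename_multilinMon]
      refine (hperm _ (g o)).trans ?_
      rw [hΘg, Finsupp.lmapDomain_apply, Finsupp.mapDomain_single]
      rfl
    -- The index `none`, the monomial with δ, is always fixed and contributes the summand 1.
    rw [cochar, Representation.character, trace_of_permutes_basis B _ _ hact, Fintype.sum_option]
    simp

theorem codim_cochar_M₁ [Infinite F] (d : L) (ρ : L →ₗ⁅F⁆ Der F (M₁ F)) (hd : ρ d = δ₁ F)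
    (hρ : ∀ γ : L, ∃ c : F, ρ γ = c • δ₁ F) {n : ℕ} (hn : 1 ≤ n) :
    codim b ρ n = n + 1 ∧
      ∀ σ, cochar b ρ n σ = 1 + ∑ k, if σ k = k then (1 : F) else 0 := by
  obtain ⟨c₀, c₁, heval, -, hker⟩ := IdL_M₁ (b := b) d ρ hd hρ
  refine codim_cochar_of_normalForm hker (normalForm_permVars c₀ c₁)
    (fun f hf => normalForm_mem_span c₀ c₁ hf)
    (exists_multilin hn (fun j => xpow b j 1) (xpow b 0 (UniversalEnvelopingAlgebra.ι F d))
      (fun j => xpow_mem_wordSpan b j _) (xpow_mem_wordSpan b 0 _) fun s t => ?_)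
  choose a ha using fun j => exists_M₁ (s j) (t j)
  obtain rfl : (fun j => entry₁ 1 1 (a j)) = s := funext fun j => (ha j).1
  obtain rfl : (fun j => entry₁ 0 1 (a j)) = t := funext fun j => (ha j).2
  refine ⟨(entry₁ 1 1).comp (evalAt b ρ a : FreeDiff F I →ₗ[F] M₁ F),
    (entry₁ 0 1).comp (evalAt b ρ a : FreeDiff F I →ₗ[F] M₁ F), heval a, fun f g => ?_,
    fun j => ?_, fun j => ?_, ?_⟩
  · simp [entry₁_mul]
  · simp [evalAt_xpow]
  · simp [evalAt_xpow]
  · simp [-UniversalEnvelopingAlgebra.ι_apply, evalAt_xpow, uAct_ι, hd, entry₁_δ₁]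

theorem codim_cochar_M₂ [Infinite F] (d : L) (ρ : L →ₗ⁅F⁆ Der F (M₂ F)) (hd : ρ d = δ₂ F)
    (hρ : ∀ γ : L, ∃ c : F, ρ γ = c • δ₂ F) {n : ℕ} (hn : 1 ≤ n) :
    codim b ρ n = n + 1 ∧
      ∀ σ, cochar b ρ n σ = 1 + ∑ k, if σ k = k then (1 : F) else 0 := by
  obtain ⟨c₀, c₁, heval, -, hker⟩ := IdL_M₂ (b := b) d ρ hd hρ
  -- The preimages are found for `normalForm` itself. Reversing them gives preimages for
  -- `normalForm` ∘ `reverse`, the map whose kernel is the ideal of identities.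
  have hex := exists_multilin (Θ := normalForm c₀ c₁) hn (fun j => xpow b j 1)
    (xpow b 0 (UniversalEnvelopingAlgebra.ι F d))
    (fun j => xpow_mem_wordSpan b j _) (xpow_mem_wordSpan b 0 _) fun s t => ?_
  · refine codim_cochar_of_normalForm hker (fun σ f => ?_)
      (fun f hf => normalForm_mem_span c₀ c₁ (reverse_mem_multilin hf)) fun o => ?_
    · rw [LinearMap.comp_apply, reverse_permVars, normalForm_permVars, LinearMap.comp_apply]
    · obtain ⟨f, hf, hf'⟩ := hex o
      exact ⟨reverse f, reverse_mem_multilin hf, by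
        rw [LinearMap.comp_apply, reverse_reverse, hf']⟩
  choose a ha using fun j => exists_M₂ (s j) (t j)
  obtain rfl : (fun j => entry₂ 0 0 (a j)) = s := funext fun j => (ha j).1
  obtain rfl : (fun j => entry₂ 0 1 (a j)) = t := funext fun j => (ha j).2
  refine ⟨((entry₂ 0 0).comp (evalAt b ρ a : FreeDiff F I →ₗ[F] M₂ F)).comp reverse,
    ((entry₂ 0 1).comp (evalAt b ρ a : FreeDiff F I →ₗ[F] M₂ F)).comp reverse, heval a,
    fun f g => ?_, fun j => ?_, fun j => ?_, ?_⟩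
  · simp [reverse_mul, entry₂_mul, mul_comm]
  · simp [reverse_xpow, evalAt_xpow]
  · simp [reverse_xpow, evalAt_xpow]
  · simp [-UniversalEnvelopingAlgebra.ι_apply, reverse_xpow, evalAt_xpow, uAct_ι, hd, entry₂_δ₂]

end Cocharacters

/-! ### The Specht characters of (n) and (n - 1, 1) -/

section SpechtCharacters

variable {F : Type u} [Field F] {n : ℕ}

theorem trace_one_of_finrank_eq_one {V : Type*} [AddCommGroup V] [Module F V]
    (h : Module.finrank F V = 1) : LinearMap.trace F V 1 = 1 := by
  have := Module.finite_of_finrank_eq_succ h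
  rw [LinearMap.trace_one, h, Nat.cast_one]

theorem trace_eq_of_intertwines {V W : Type*} [AddCommGroup V] [Module F V] [AddCommGroup W]
    [Module F W] (e : V ≃ₗ[F] W) {f : Module.End F V} {g : Module.End F W}
    (h : ∀ x, g (e x) = e (f x)) : LinearMap.trace F W g = LinearMap.trace F V f := by
  rw [← LinearMap.trace_conj' f e]
  congr 1
  refine LinearMap.ext fun y => ?_
  obtain ⟨x, rfl⟩ := e.surjective y
  rw [LinearEquiv.conj_apply_apply, LinearEquiv.symm_apply_apply, h]

theorem trace_sub_smulRight {V : Type*} [AddCommGroup V] [Module F V] [Module.Finite F V]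
    (f : Module.End F V) (φ : V →ₗ[F] F) (v : V) :
    LinearMap.trace F V (f - φ.smulRight v) = LinearMap.trace F V f - φ v := by
  rw [map_sub, LinearMap.trace_smulRight]

theorem mem_oneRow {c : ℕ × ℕ} : c ∈ (oneRow n).cells ↔ c.1 = 0 ∧ c.2 < n := by
  obtain ⟨i, j⟩ := c
  rw [YoungDiagram.mem_cells, oneRow, YoungDiagram.mem_ofRowLens]
  rcases i with _ | i <;> simp

theorem mem_hook {hn : 2 ≤ n} {c : ℕ × ℕ} :
    c ∈ (hook n hn).cells ↔ (c.1 = 0 ∧ c.2 < n - 1) ∨ (c.1 = 1 ∧ c.2 = 0) := by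
  obtain ⟨i, j⟩ := c
  rw [YoungDiagram.mem_cells, hook, YoungDiagram.mem_ofRowLens]
  rcases i with _ | _ | i <;> simp

/-- Every column has one cell, so only the identity preserves the columns. -/
theorem polytabloid_oneRow (t : Fin n ≃ (oneRow n).cells) :
    polytabloid F t = Finsupp.single 0 1 := by
  classical
  have h0 : ∀ k, (t k : ℕ × ℕ).1 = 0 := fun k => (mem_oneRow.1 (t k).2).1
  have ht : tabloid t = 0 := funext h0
  have hf : ∀ σ : Equiv.Perm (Fin n), (∀ k, (t (σ k) : ℕ × ℕ).2 = (t k : ℕ × ℕ).2) ↔ σ = 1 := by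
    refine fun σ => ⟨fun h => Equiv.ext fun k => t.injective (Subtype.ext (Prod.ext ?_ (h k))), ?_⟩
    · rw [h0, h0]
    · rintro rfl k
      rfl
  rw [polytabloid]
  simp only [hf, Finset.filter_eq', Finset.mem_univ, if_true, Finset.sum_singleton, ht]
  simp

theorem spechtChar_oneRow (n : ℕ) (σ : Equiv.Perm (Fin n)) : spechtChar F n (oneRow n) σ = 1 := by
  have t : Fin n ≃ (oneRow n).cells :=
    { toFun := fun k => ⟨(0, k), mem_oneRow.2 ⟨rfl, k.2⟩⟩
      invFun := fun c => ⟨c.1.2, (mem_oneRow.1 c.2).2⟩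
      left_inv := fun k => rfl
      right_inv := fun c => Subtype.ext (Prod.ext (mem_oneRow.1 c.2).1.symm rfl) }
  have hS : specht F n (oneRow n) = Submodule.span F {Finsupp.single 0 1} := by
    rw [specht]
    congr 1
    ext f
    simp only [Set.mem_range, polytabloid_oneRow, Set.mem_singleton_iff, eq_comm]
    exact ⟨fun ⟨_, h⟩ => h, fun h => ⟨t, h⟩⟩
  have hid : ((tabloidRep F n).subrepresentation (specht F n (oneRow n))
      (specht_invariant F n (oneRow n))) σ = 1 := by
    refine LinearMap.ext fun ⟨x, hx⟩ => Subtype.ext ?_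
    change tabloidRep F n σ x = x
    rw [hS, Submodule.mem_span_singleton] at hx
    obtain ⟨c, rfl⟩ := hx
    simp [tabloidRep]
    rfl
  have hdim : Module.finrank F (specht F n (oneRow n)) = 1 := by
    rw [hS, finrank_span_singleton (by simp)]
  rw [spechtChar, Representation.character, hid]
  exact trace_one_of_finrank_eq_one (F := F) (V := specht F n (oneRow n)) hdim

/-- The tabloid of shape `(n - 1, 1)` with `k` in the second row. -/
def hookTabloid (k : Fin n) : Fin n → ℕ := fun i => if i = k then 1 else 0

theorem hookTabloid_injective : Function.Injective (hookTabloid (n := n)) := by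
  intro k k' h
  by_contra hne
  have := congrFun h k
  simp [hookTabloid, hne] at this

theorem tabloidRep_hookTabloid (σ : Equiv.Perm (Fin n)) (k : Fin n) :
    tabloidRep F n σ (Finsupp.single (hookTabloid k) 1) =
      Finsupp.single (hookTabloid (σ k)) 1 := by
  have : (fun i => hookTabloid k (σ⁻¹ i)) = hookTabloid (σ k) := by
    funext i
    simp only [hookTabloid, Equiv.Perm.inv_eq_iff_eq]
  exact Finsupp.mapDomain_single.trans (congrArg (fun r => Finsupp.single r 1) this)

/-- Only the first column has two cells, so the column group is generated by the transposition of k₀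
and k₁, which has sign -1. -/
theorem polytabloid_hook {hn : 2 ≤ n} (t : Fin n ≃ (hook n hn).cells) {k₀ k₁ : Fin n}
    (h₀ : (t k₀ : ℕ × ℕ) = (0, 0)) (h₁ : (t k₁ : ℕ × ℕ) = (1, 0)) :
    polytabloid F t = Finsupp.single (hookTabloid k₁) 1 - Finsupp.single (hookTabloid k₀) 1 := by
  classical
  have hne : k₀ ≠ k₁ := by
    rintro rfl
    simp [h₀] at h₁
  have hinj : ∀ k k', (t k : ℕ × ℕ) = t k' → k = k' := fun k k' h => t.injective (Subtype.ext h)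
  have hcol : ∀ k, (t k : ℕ × ℕ).2 = 0 → k = k₀ ∨ k = k₁ := by
    intro k hk
    rcases mem_hook.1 (t k).2 with h | h
    · exact Or.inl (hinj _ _ ((Prod.ext h.1 hk).trans h₀.symm))
    · exact Or.inr (hinj _ _ ((Prod.ext h.1 hk).trans h₁.symm))
  have hrow : ∀ k, (t k : ℕ × ℕ).2 ≠ 0 → (t k : ℕ × ℕ).1 = 0 := by
    intro k hk
    rcases mem_hook.1 (t k).2 with h | h
    · exact h.1
    · exact absurd h.2 hk
  have ht : tabloid t = hookTabloid k₁ := by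
    funext k
    by_cases hk : k = k₁
    · subst hk
      simp [tabloid, hookTabloid, h₁]
    · rcases mem_hook.1 (t k).2 with h | h
      · simp [tabloid, hookTabloid, hk, h.1]
      · exact absurd (hinj _ _ ((Prod.ext h.1 h.2).trans h₁.symm)) hk
  have hf : (Finset.univ.filter fun σ : Equiv.Perm (Fin n) =>
      ∀ k, (t (σ k) : ℕ × ℕ).2 = (t k : ℕ × ℕ).2) = {1, Equiv.swap k₀ k₁} := by
    ext σ
    simp only [Finset.mem_filter, Finset.mem_univ, true_and, Finset.mem_insert,
      Finset.mem_singleton]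
    constructor
    · intro h
      have hfix : ∀ k, k ≠ k₀ → k ≠ k₁ → σ k = k := by
        intro k hk₀ hk₁
        have hk : (t k : ℕ × ℕ).2 ≠ 0 := fun hk => (hcol k hk).elim hk₀ hk₁
        refine hinj _ _ (Prod.ext ?_ (h k))
        rw [hrow k hk, hrow (σ k) (by rwa [h k])]
      have hσ₀ := hcol (σ k₀) (by rw [h, h₀])
      have hσ₁ := hcol (σ k₁) (by rw [h, h₁])
      rcases hσ₀ with hσ₀ | hσ₀
      · have hσ₁ : σ k₁ = k₁ :=
          hσ₁.resolve_left fun h => hne (σ.injective (hσ₀.trans h.symm))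
        left
        ext1 k
        by_cases hk₀ : k = k₀
        · rw [hk₀, hσ₀]; rfl
        by_cases hk₁ : k = k₁
        · rw [hk₁, hσ₁]; rfl
        exact hfix k hk₀ hk₁
      · have hσ₁ : σ k₁ = k₀ :=
          hσ₁.resolve_right fun h => hne (σ.injective (hσ₀.trans h.symm))
        right
        ext1 k
        by_cases hk₀ : k = k₀
        · rw [hk₀, hσ₀, Equiv.swap_apply_left]
        by_cases hk₁ : k = k₁
        · rw [hk₁, hσ₁, Equiv.swap_apply_right]
        rw [hfix k hk₀ hk₁, Equiv.swap_apply_of_ne_of_ne hk₀ hk₁]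
    · rintro (rfl | rfl) k
      · rfl
      · by_cases hk₀ : k = k₀
        · rw [hk₀, Equiv.swap_apply_left, h₀, h₁]
        by_cases hk₁ : k = k₁
        · rw [hk₁, Equiv.swap_apply_right, h₀, h₁]
        rw [Equiv.swap_apply_of_ne_of_ne hk₀ hk₁]
  have h1 : (1 : Equiv.Perm (Fin n)) ≠ Equiv.swap k₀ k₁ := fun h =>
    hne (Equiv.swap_eq_one_iff.1 h.symm)
  have hsum : polytabloid F t = ∑ σ ∈ ({1, Equiv.swap k₀ k₁} : Finset (Equiv.Perm (Fin n))),
      ((Equiv.Perm.sign σ : ℤ) : F) • tabloidRep F n σ (Finsupp.single (tabloid t) 1) := by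
    rw [polytabloid]
    exact Finset.sum_congr (by rw [← hf]) fun _ _ => rfl
  rw [hsum, Finset.sum_pair h1, ht, tabloidRep_hookTabloid, tabloidRep_hookTabloid,
    Equiv.Perm.sign_swap hne, Equiv.swap_apply_right, sub_eq_add_neg]
  simp

/-- The sum of the coefficients. -/
def coeffSum (F : Type u) [Field F] (n : ℕ) : (Fin n →₀ F) →ₗ[F] F :=
  Finsupp.linearCombination F fun _ => (1 : F)

theorem coeffSum_single (k : Fin n) (c : F) : coeffSum F n (Finsupp.single k c) = c := by
  simp [coeffSum]

theorem coeffSum_lmapDomain (σ : Equiv.Perm (Fin n)) (x : Fin n →₀ F) :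
    coeffSum F n (Finsupp.lmapDomain F F σ x) = coeffSum F n x := by
  refine LinearMap.congr_fun (f := (coeffSum F n).comp (Finsupp.lmapDomain F F σ))
    (Finsupp.lhom_ext' fun k => LinearMap.ext_ring ?_) x
  simp [coeffSum]

theorem exists_hook_tableau (hn : 2 ≤ n) : Nonempty (Fin n ≃ (hook n hn).cells) := by
  refine ⟨
    { toFun := fun k => if hk : (k : ℕ) < n - 1 then ⟨(0, k), mem_hook.2 (Or.inl ⟨rfl, hk⟩)⟩
        else ⟨(1, 0), mem_hook.2 (Or.inr ⟨rfl, rfl⟩)⟩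
      invFun := fun c => if hc : c.1.1 = 0 ∧ c.1.2 < n then ⟨c.1.2, hc.2⟩ else ⟨n - 1, by omega⟩
      left_inv := fun k => ?_
      right_inv := fun ⟨⟨i, j⟩, hc⟩ => ?_ }⟩
  · by_cases hk : (k : ℕ) < n - 1
    · simp [hk]
    · simp only [hk, dite_false]
      refine Fin.ext ?_
      have := k.2
      simp
      omega
  · rcases mem_hook.1 hc with ⟨rfl, h⟩ | ⟨rfl, rfl⟩
    · simp only at h
      have : j < n := by omega
      simp [h, this]
    · simp

/-- Any tableau can be corrected by two transpositions of cells. The second one leaves (0, 0) alone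
because j is not placed there. -/
theorem exists_hook_tableau_of_ne (hn : 2 ≤ n) {i j : Fin n} (hij : i ≠ j) :
    ∃ t : Fin n ≃ (hook n hn).cells, (t i : ℕ × ℕ) = (0, 0) ∧ (t j : ℕ × ℕ) = (1, 0) := by
  obtain ⟨t⟩ := exists_hook_tableau hn
  let c₀ : (hook n hn).cells := ⟨(0, 0), mem_hook.2 (Or.inl ⟨rfl, by simp; omega⟩)⟩
  let c₁ : (hook n hn).cells := ⟨(1, 0), mem_hook.2 (Or.inr ⟨rfl, rfl⟩)⟩
  have hc : c₁ ≠ c₀ := fun h => by simpa [c₀, c₁] using congrArg Subtype.val h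
  let t' := t.trans (Equiv.swap (t i) c₀)
  have hi : t' i = c₀ := by simp [t']
  have hj : c₀ ≠ t' j := fun h => hij (t'.injective (hi.trans h))
  refine ⟨t'.trans (Equiv.swap (t' j) c₁), ?_, ?_⟩
  · rw [Equiv.trans_apply, hi, Equiv.swap_apply_of_ne_of_ne hj hc.symm]
  · rw [Equiv.trans_apply, Equiv.swap_apply_left]

/-- The polytabloids are the differences of two hook tabloids, and these differences span the
vectors with coefficient sum zero. -/
theorem specht_hook (hn : 2 ≤ n) : specht F n (hook n hn) =
    (LinearMap.ker (coeffSum F n)).map (Finsupp.lmapDomain F F hookTabloid) := by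
  apply le_antisymm
  · rw [specht, Submodule.span_le]
    rintro _ ⟨t, rfl⟩
    change polytabloid F t ∈ _
    rw [polytabloid_hook t (k₀ := t.symm ⟨(0, 0), mem_hook.2 (Or.inl ⟨rfl, by simp; omega⟩)⟩)
      (k₁ := t.symm ⟨(1, 0), mem_hook.2 (Or.inr ⟨rfl, rfl⟩)⟩) (by simp) (by simp)]
    refine ⟨Finsupp.single (t.symm ⟨(1, 0), mem_hook.2 (Or.inr ⟨rfl, rfl⟩)⟩) 1 -
      Finsupp.single (t.symm ⟨(0, 0), mem_hook.2 (Or.inl ⟨rfl, by simp; omega⟩)⟩) 1, ?_, ?_⟩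
    · rw [SetLike.mem_coe, LinearMap.mem_ker, map_sub, coeffSum_single, coeffSum_single, sub_self]
    · rw [map_sub, Finsupp.lmapDomain_apply, Finsupp.lmapDomain_apply, Finsupp.mapDomain_single,
        Finsupp.mapDomain_single]
  · rw [Submodule.map_le_iff_le_comap]
    intro x hx
    let o : Fin n := ⟨0, by omega⟩
    -- Subtracting the same basis vector at o from every term costs nothing, as the coefficients sum
    -- to zero.
    have hx' : x = x.sum fun k c => c • (Finsupp.single k (1 : F) - Finsupp.single o 1) := by
      have h1 : x.sum (fun k c => c • (Finsupp.single k (1 : F))) = x := by simp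
      have h2 : x.sum (fun _ c => c • (Finsupp.single o (1 : F))) = 0 := by
        have h3 : coeffSum F n x = ∑ k ∈ x.support, x k := by
          simp [coeffSum, Finsupp.linearCombination_apply, Finsupp.sum]
        rw [Finsupp.sum, ← Finset.sum_smul, ← h3, LinearMap.mem_ker.1 hx, zero_smul]
      simp only [smul_sub, Finsupp.sum_sub, h1, h2, sub_zero]
    rw [hx']
    refine Submodule.sum_mem _ fun k _ => Submodule.smul_mem _ _ ?_
    rw [Submodule.mem_comap, map_sub, Finsupp.lmapDomain_apply, Finsupp.lmapDomain_apply,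
      Finsupp.mapDomain_single, Finsupp.mapDomain_single]
    by_cases hk : k = o
    · rw [hk, sub_self]
      exact zero_mem _
    · obtain ⟨t, h₀, h₁⟩ := exists_hook_tableau_of_ne hn (Ne.symm hk)
      exact Submodule.subset_span ⟨t, polytabloid_hook t h₀ h₁⟩

theorem trace_restrict_ker_coeffSum (hn : 2 ≤ n) (σ : Equiv.Perm (Fin n))
    (hσ : ∀ x ∈ LinearMap.ker (coeffSum F n),
      Finsupp.lmapDomain F F σ x ∈ LinearMap.ker (coeffSum F n)) :
    LinearMap.trace F _ ((Finsupp.lmapDomain F F σ).restrict hσ) =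
      (∑ k, if σ k = k then (1 : F) else 0) - 1 := by
  let o : Fin n := ⟨0, by omega⟩
  let P : (Fin n →₀ F) →ₗ[F] (Fin n →₀ F) := Finsupp.lmapDomain F F σ
  -- A rank-one correction of P that vanishes on the kernel of `coeffSum` and sends the whole space
  -- into it. Hence the trace on the kernel equals the trace of f, which is that of P minus
  -- `coeffSum` of P e_o, namely 1.
  let f : (Fin n →₀ F) →ₗ[F] (Fin n →₀ F) := P - (coeffSum F n).smulRight (P (Finsupp.single o 1))
  have hf : ∀ x, f x ∈ LinearMap.ker (coeffSum F n) := by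
    intro x
    simp [f, P, -Finsupp.lmapDomain_apply, coeffSum_lmapDomain, coeffSum_single]
  have hr : (Finsupp.lmapDomain F F σ).restrict hσ = f.restrict fun x _ => hf x := by
    refine LinearMap.ext fun ⟨x, hx⟩ => Subtype.ext ?_
    rw [LinearMap.mem_ker] at hx
    simp [f, P, hx]
  have hP : LinearMap.trace F _ P = ∑ k, if σ k = k then (1 : F) else 0 := by
    refine trace_of_permutes_basis Finsupp.basisSingleOne P σ fun k => ?_
    simp [P]
  rw [hr, LinearMap.trace_restrict_eq_of_forall_mem _ _ hf]
  refine (trace_sub_smulRight P (coeffSum F n) _).trans ?_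
  rw [hP]
  congr 1
  simp [P, -Finsupp.lmapDomain_apply, coeffSum_lmapDomain, coeffSum_single]

theorem spechtChar_hook (hn : 2 ≤ n) (σ : Equiv.Perm (Fin n)) :
    spechtChar F n (hook n hn) σ = (∑ k, if σ k = k then (1 : F) else 0) - 1 := by
  have hσ : ∀ x ∈ LinearMap.ker (coeffSum F n),
      Finsupp.lmapDomain F F σ x ∈ LinearMap.ker (coeffSum F n) := by
    intro x hx
    rw [LinearMap.mem_ker] at hx ⊢
    rw [coeffSum_lmapDomain, hx]
  let e : LinearMap.ker (coeffSum F n) ≃ₗ[F] specht F n (hook n hn) :=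
    (Submodule.equivMapOfInjective (Finsupp.lmapDomain F F hookTabloid)
      (Finsupp.mapDomain_injective hookTabloid_injective) _).trans
      (LinearEquiv.ofEq _ _ (specht_hook hn).symm)
  have he : ∀ x, (e x : (Fin n → ℕ) →₀ F) = Finsupp.lmapDomain F F hookTabloid x := fun x => rfl
  rw [spechtChar, Representation.character, ← trace_restrict_ker_coeffSum hn σ hσ]
  refine trace_eq_of_intertwines (F := F) (V := LinearMap.ker (coeffSum F n))
    (W := specht F n (hook n hn)) e fun x => Subtype.ext ?_
  rw [he]
  change tabloidRep F n σ (Finsupp.lmapDomain F F hookTabloid x) =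
    Finsupp.lmapDomain F F hookTabloid (Finsupp.lmapDomain F F σ x)
  refine LinearMap.congr_fun
    (f := (tabloidRep F n σ).comp (Finsupp.lmapDomain F F hookTabloid))
    (g := (Finsupp.lmapDomain F F hookTabloid).comp (Finsupp.lmapDomain F F σ))
    (Finsupp.lhom_ext' fun k => LinearMap.ext_ring ?_) (x : Fin n →₀ F)
  simp [tabloidRep_hookTabloid]

end SpechtCharacters

end DiffId

end

/-! ### The theorem assembled -/

theorem mainTheorem5 {F : Type*} [Field F] [CharZero F] {L : Type*} [LieRing L] [LieAlgebra F L]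
    {I : Type*} (b : Module.Basis I F (UniversalEnvelopingAlgebra F L)) (d : L)
    (ρ₁ : L →ₗ⁅F⁆ DiffId.Der F (DiffId.M₁ F)) (ρ₂ : L →ₗ⁅F⁆ DiffId.Der F (DiffId.M₂ F))
    (hd₁ : ρ₁ d = DiffId.δ₁ F) (hd₂ : ρ₂ d = DiffId.δ₂ F)
    (hρ₁ : ∀ γ : L, ∃ c : F, ρ₁ γ = c • DiffId.δ₁ F)
    (hρ₂ : ∀ γ : L, ∃ c : F, ρ₂ γ = c • DiffId.δ₂ F) :
    ((Function.Injective ρ₁ → DiffId.IdL b ρ₁ = DiffId.TLSpan b (DiffId.gens₁ b d)) ∧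
      (Function.Injective ρ₂ → DiffId.IdL b ρ₂ = DiffId.TLSpan b (DiffId.gens₂ b d)) ∧
      DiffId.IdL b ρ₁ = DiffId.TLSpan b (DiffId.gens₁ b d ∪ DiffId.trivGens b ρ₁) ∧
      DiffId.IdL b ρ₂ = DiffId.TLSpan b (DiffId.gens₂ b d ∪ DiffId.trivGens b ρ₂)) ∧
    (∀ n : ℕ, 1 ≤ n → DiffId.codim b ρ₁ n = n + 1 ∧ DiffId.codim b ρ₂ n = n + 1) ∧
    (∀ (n : ℕ) (hn : 2 ≤ n),
      DiffId.cochar b ρ₁ n = 2 • DiffId.spechtChar F n (DiffId.oneRow n) +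
        DiffId.spechtChar F n (DiffId.hook n hn) ∧
      DiffId.cochar b ρ₂ n = 2 • DiffId.spechtChar F n (DiffId.oneRow n) +
        DiffId.spechtChar F n (DiffId.hook n hn)) ∧
    (DiffId.cochar b ρ₁ 1 = 2 • DiffId.spechtChar F 1 (DiffId.oneRow 1) ∧
      DiffId.cochar b ρ₂ 1 = 2 • DiffId.spechtChar F 1 (DiffId.oneRow 1)) := by
  have : Infinite F := CharZero.infinite F
  obtain ⟨-, -, -, h₁, -⟩ := DiffId.IdL_M₁ (b := b) d ρ₁ hd₁ hρ₁
  obtain ⟨-, -, -, h₂, -⟩ := DiffId.IdL_M₂ (b := b) d ρ₂ hd₂ hρ₂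
  have hc₁ := fun {n : ℕ} (hn : 1 ≤ n) => DiffId.codim_cochar_M₁ (b := b) d ρ₁ hd₁ hρ₁ hn
  have hc₂ := fun {n : ℕ} (hn : 1 ≤ n) => DiffId.codim_cochar_M₂ (b := b) d ρ₂ hd₂ hρ₂ hn
  have hhook : ∀ (n : ℕ) (hn : 2 ≤ n) (χ : Equiv.Perm (Fin n) → F),
      (∀ σ, χ σ = 1 + ∑ k, if σ k = k then (1 : F) else 0) →
      χ = 2 • DiffId.spechtChar F n (DiffId.oneRow n) +
        DiffId.spechtChar F n (DiffId.hook n hn) := by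
    intro n hn χ hχ
    funext σ
    rw [hχ, Pi.add_apply, Pi.smul_apply, DiffId.spechtChar_oneRow, DiffId.spechtChar_hook, two_smul]
    ring
  -- For n = 1 there is no partition (n - 1, 1). The only permutation has one fixed point, so the
  -- character takes the value 2.
  have hone : ∀ χ : Equiv.Perm (Fin 1) → F,
      (∀ σ, χ σ = 1 + ∑ k, if σ k = k then (1 : F) else 0) →
      χ = 2 • DiffId.spechtChar F 1 (DiffId.oneRow 1) := by
    intro χ hχ
    funext σ
    rw [hχ, Pi.smul_apply, DiffId.spechtChar_oneRow, two_smul, Fintype.sum_unique,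
      if_pos (Subsingleton.elim _ _)]
  refine ⟨⟨fun hi => ?_, fun hi => ?_, h₁, h₂⟩, fun n hn => ⟨(hc₁ hn).1, (hc₂ hn).1⟩,
    fun n hn => ⟨hhook n hn _ (hc₁ (by omega)).2, hhook n hn _ (hc₂ (by omega)).2⟩,
    hone _ (hc₁ le_rfl).2, hone _ (hc₂ le_rfl).2⟩
  · rw [h₁, DiffId.TLSpan_union_trivGens_of_injective hi]
  · rw [h₂, DiffId.TLSpan_union_trivGens_of_injective hi]
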